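/- \textbf{($\ell_2$ concentration of the greedy OLS estimator, unbounded contexts.)} \emph{Setup.} Let $d\ge 1$, $K\ge 2$, $T\ge 1$ be integers, $\theta^\star,\theta_0\in\mathbb R^d$, $\sigma\ge 0$. In each round $t=1,\dots,T$ random contexts $X_1(t),\dots,X_K(t)\in\mathbb R^d$ are drawn; the context sets of different rounds are independent, while contexts within a round may be dependent and the distributions may change with $t$. An arm $a(t)\in\{1,\dots,K\}$ is pulled and the reward $Y_{a(t)}(t)=X_{a(t)}(t)^\top\theta^\star+\eta_{a(t)}(t)$ is observed. Let $\mathcal H_t$ be the $\sigma$-field generated by $a(s)$, $X_{a(s)}(s)$, $Y_{a(s)}(s)$ for $1\le s\le t$. Given $\mathcal G_t:=\sigma(\mathcal H_{t-1},a(t),X_{a(t)}(t))$ the noise has mean zero and is $\sigma$-sub-Gaussian: $\mathbb E[\eta_{a(t)}(t)\mid\mathcal G_t]=0$ and $\mathbb E[e^{u\eta_{a(t)}(t)}\mid\mathcal G_t]\le e^{u^2\sigma^2/2}$ for all $u\in\mathbb R$. Put $\Sigma(t)=\sum_{s=1}^t X_{a(s)}(s)X_{a(s)}(s)^\top$, $b(t)=\sum_{s=1}^t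 Y_{a(s)}(s)X_{a(s)}(s)$ and, when $\Sigma(t)$ is invertible, $\hat\theta_t=\Sigma(t)^{-1}b(t)$. The arms are pulled greedily: $a(t)\in\arg\max_i X_i(t)^\top\theta_0$ while $\Sigma(t-1)$ is singular, and $a(t)\in\arg\max_i X_i(t)^\top\hat\theta_{t-1}$ afterwards (ties broken arbitrarily). Assume that $\|X_i(t)\|_{\psi_1}\le x_{\max}$ for all $i$ and all $t\le T$, where $\|Z\|_{\psi_1}=\sup_{p\ge1}p^{-1}(\mathbb E|Z|^p)^{1/p}$ for a real random variable and $\|X\|_{\psi_1}=\sup_{\|u\|_2=1}\|\langle u,X\rangle\|_{\psi_1}$ for a random vector. Assume further that $\lambda_\star>0$ is a diversity constant, that is, $\mathbb E[X_{a(t)}(t)X_{a(t)}(t)^\top\mid\mathcal H_{t-1}]\succeq\lambda_\star I_d$ almost surely for all $1\le t\le T$. \emph{Claim.} There are absolute constants $c_0,c_1,c>0$ such that in every such setup, with $$L:=c_0\sqrt d\,x_{\max}\Bigl(1+3\log\frac{dKT}{\min(\lambda_\star,1)}\Bigr),\qquad T_1:=\frac{2}{c_1}\,\frac{L^2}{\lambda_\star}\,(2\log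 T+\log d),$$ for each integer $t$ with $1\le t\le T$ and $t\ge T_1$, with probability at least $1-\frac{4}{T^2}$ the matrix $\Sigma(t)$ is invertible and $$\|\hat\theta_t-\theta^\star\|_2\le c\,\sigma\,\frac{\sqrt{d\log T}}{\sqrt{\lambda_\star t}}.$$ -/

import Mathlib

open MeasureTheory ProbabilityTheory
open scoped ENNReal

noncomputable section

/-- `ℝ^d` with the Euclidean norm. -/
abbrev Vec (d : ℕ) := EuclideanSpace ℝ (Fin d)

/-! ### Sub-exponential norms -/

/-- The norm `‖Z‖_{ψ₁} = sup_{p ≥ 1} p⁻¹ (E |Z|^p)^{1/p}` of a real random variable, with values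
in `[0, ∞]`. -/
def psiOneNorm {Ω : Type*} [MeasurableSpace Ω] (μ : Measure Ω) (Z : Ω → ℝ) : ℝ≥0∞ :=
  ⨆ (p : ℝ) (_ : 1 ≤ p), eLpNorm Z (ENNReal.ofReal p) μ / ENNReal.ofReal p

/-- The norm `‖X‖_{ψ₁} = sup_{‖u‖₂ = 1} ‖⟨u, X⟩‖_{ψ₁}` of a random vector. -/
def psiOneNormVec {Ω : Type*} [MeasurableSpace Ω] {d : ℕ} (μ : Measure Ω) (X : Ω → Vec d) :
    ℝ≥0∞ :=
  ⨆ (u : Vec d) (_ : ‖u‖ = 1), psiOneNorm μ (fun ω => inner ℝ u (X ω))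

/-! ### Ordinary least squares -/

/-- The Gram matrix `Σ(t) = ∑_{s=1}^t x_s x_sᵀ`. -/
def gram {d : ℕ} (x : ℕ → Vec d) (t : ℕ) : Matrix (Fin d) (Fin d) ℝ :=
  ∑ s ∈ Finset.Icc 1 t, Matrix.vecMulVec (x s).ofLp (x s).ofLp

/-- The vector `b(t) = ∑_{s=1}^t y_s x_s`. -/
def respSum {d : ℕ} (x : ℕ → Vec d) (y : ℕ → ℝ) (t : ℕ) : Vec d :=
  ∑ s ∈ Finset.Icc 1 t, y s • x s

/-- The OLS estimate `Σ(t)⁻¹ b(t)`; meaningful when `Σ(t)` is invertible. -/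
def ols {d : ℕ} (x : ℕ → Vec d) (y : ℕ → ℝ) (t : ℕ) : Vec d :=
  WithLp.toLp 2 ((gram x t)⁻¹.mulVec (respSum x y t).ofLp)

open Classical in
/-- The parameter with respect to which the greedy algorithm acts once the data of rounds
`1, …, t` are known: the initial `θ₀` as long as `Σ(t)` is singular (equivalently, since `Σ(t)` is
positive semidefinite, as long as its least eigenvalue is `0`), the OLS estimate afterwards. -/
def greedyParam {d : ℕ} (θ₀ : Vec d) (x : ℕ → Vec d) (y : ℕ → ℝ) (t : ℕ) : Vec d :=
  if IsUnit (gram x t).det then ols x y t else θ₀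

/-! ### The bandit model. Rounds are `1, …, T`, arms are `Fin K`. -/

/-- The quantity of the arm pulled in round `t`, e.g. `X_{a(t)}(t)`. -/
def chosen {Ω β : Type*} {K : ℕ} (a : ℕ → Ω → Fin K) (Z : ℕ → Fin K → Ω → β) (t : ℕ) (ω : Ω) : β :=
  Z t (a t ω) ω

/-- The rewards `Y_i(t) = X_i(t)ᵀ θ⋆ + η_i(t)`. -/
def reward {Ω : Type*} {d K : ℕ} (θs : Vec d) (X : ℕ → Fin K → Ω → Vec d)
    (η : ℕ → Fin K → Ω → ℝ) (t : ℕ) (i : Fin K) (ω : Ω) : ℝ :=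
  inner ℝ (X t i ω) θs + η t i ω

/-- The history `ℋ_t`, generated by the pulled arms, their contexts and their rewards in rounds
`1, …, t`. -/
def history {Ω : Type*} {d K : ℕ} (a : ℕ → Ω → Fin K) (X : ℕ → Fin K → Ω → Vec d)
    (Y : ℕ → Fin K → Ω → ℝ) (t : ℕ) : MeasurableSpace Ω :=
  ⨆ s ∈ Finset.Icc 1 t,
    MeasurableSpace.comap (a s) inferInstance ⊔
    MeasurableSpace.comap (chosen a X s) inferInstance ⊔
    MeasurableSpace.comap (chosen a Y s) inferInstance

/-- The information just before the reward of round `t` is revealed: `ℋ_{t-1}` together with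
the arm pulled in round `t` and its context. -/
def preReward {Ω : Type*} {d K : ℕ} (a : ℕ → Ω → Fin K) (X : ℕ → Fin K → Ω → Vec d)
    (Y : ℕ → Fin K → Ω → ℝ) (t : ℕ) : MeasurableSpace Ω :=
  history a X Y (t - 1) ⊔
    (MeasurableSpace.comap (a t) inferInstance ⊔
      MeasurableSpace.comap (chosen a X t) inferInstance)

/-- The contexts `X`, noises `η` and arms `a` are those of a run over `T` rounds of the greedy
algorithm started at `θ₀`, in a linear bandit with parameter `θs`, with contexts that are
independent across rounds and conditionally `σ`-sub-Gaussian noise. -/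
structure IsLinGreedyRun {Ω : Type*} [MeasurableSpace Ω] {d K : ℕ} (μ : Measure Ω) (T : ℕ)
    (θs θ₀ : Vec d) (σ : ℝ) (X : ℕ → Fin K → Ω → Vec d) (η : ℕ → Fin K → Ω → ℝ)
    (a : ℕ → Ω → Fin K) : Prop where
  measurable_context : ∀ t ∈ Finset.Icc 1 T, ∀ i, Measurable (X t i)
  measurable_noise : ∀ t ∈ Finset.Icc 1 T, ∀ i, Measurable (η t i)
  measurable_arm : ∀ t ∈ Finset.Icc 1 T, Measurable (a t)
  /-- The context sets of different rounds are independent; the contexts within a round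
  may be dependent. -/
  indep_contexts :
    iIndepFun (fun (t : Finset.Icc 1 T) (ω : Ω) (i : Fin K) => X (t : ℕ) i ω) μ
  /-- In round `t` the arm maximizes `X_i(t)ᵀ θ` over `i`, for the current parameter `θ`
  (ties are broken arbitrarily). -/
  greedy : ∀ t ∈ Finset.Icc 1 T, ∀ᵐ ω ∂μ, ∀ i : Fin K,
    inner ℝ (X t i ω) (greedyParam θ₀ (fun s => chosen a X s ω)
        (fun s => chosen a (reward θs X η) s ω) (t - 1)) ≤
      inner ℝ (chosen a X t ω) (greedyParam θ₀ (fun s => chosen a X s ω)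
        (fun s => chosen a (reward θs X η) s ω) (t - 1))
  /-- The noise of the pulled arm has conditional mean zero. -/
  noise_mean : ∀ t ∈ Finset.Icc 1 T,
    μ[chosen a η t | preReward a X (reward θs X η) t] =ᵐ[μ] 0
  /-- The noise of the pulled arm is conditionally `σ`-sub-Gaussian. -/
  noise_integrable : ∀ t ∈ Finset.Icc 1 T, ∀ l : ℝ,
    Integrable (fun ω => Real.exp (l * chosen a η t ω)) μ
  noise_subGaussian : ∀ t ∈ Finset.Icc 1 T, ∀ l : ℝ,
    ∀ᵐ ω ∂μ, (μ[fun ω' => Real.exp (l * chosen a η t ω') |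
        preReward a X (reward θs X η) t]) ω ≤ Real.exp (l ^ 2 * σ ^ 2 / 2)

/-- The matrix `E[Z Zᵀ | m]`, entry by entry. -/
def condSecondMoment {Ω : Type*} [MeasurableSpace Ω] {d : ℕ} (μ : Measure Ω)
    (m : MeasurableSpace Ω) (Z : Ω → Vec d) (ω : Ω) : Matrix (Fin d) (Fin d) ℝ :=
  Matrix.of fun j k => (μ[fun ω' => Z ω' j * Z ω' k | m]) ω

/-- `lam` is a diversity constant: `E[X_{a(t)}(t) X_{a(t)}(t)ᵀ | ℋ_{t-1}] ⪰ lam • I` almost surely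
in every round `t ∈ {1, …, T}`. -/
def IsDiversityConstant {Ω : Type*} [MeasurableSpace Ω] {d K : ℕ} (μ : Measure Ω) (T : ℕ)
    (X : ℕ → Fin K → Ω → Vec d) (Y : ℕ → Fin K → Ω → ℝ) (a : ℕ → Ω → Fin K) (lam : ℝ) : Prop :=
  ∀ t ∈ Finset.Icc 1 T, ∀ᵐ ω ∂μ,
    (condSecondMoment μ (history a X Y (t - 1)) (chosen a X t) ω -
      lam • (1 : Matrix (Fin d) (Fin d) ℝ)).PosSemidef

/-- The truncation radius `L = c₀ √d x_max (1 + 3 log (d K T / min(λ⋆, 1)))`. -/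
def truncRadius (c₀ : ℝ) (d K T : ℕ) (xmax lam : ℝ) : ℝ :=
  c₀ * √(d : ℝ) * xmax * (1 + 3 * Real.log ((d : ℝ) * K * T / min lam 1))

/-- The burn-in time `T₁ = (2 / c₁) (L² / λ⋆) (2 log T + log d)`. -/
def burnIn (c₀ c₁ : ℝ) (d K T : ℕ) (xmax lam : ℝ) : ℝ :=
  2 / c₁ * (truncRadius c₀ d K T xmax lam ^ 2 / lam) * (2 * Real.log T + Real.log d)

end

/-! ### The Golden–Thompson inequality -/

section LieTrotter

open Filter Topology Asymptotics

variable {𝔸 : Type*} [NormedRing 𝔸] [NormOneClass 𝔸]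

/-! Write `E` for the estimation error, `x_s` for the chosen contexts, `e_s` for their noises. The
normal equations say `∑ ⟨x_s, E⟩ ⟨x_s, v⟩ = ∑ e_s ⟨x_s, v⟩` for every `v`, so the error is
controlled by two facts: the Gram matrix dominates `(λ t / 8) I`, and the noise sums on the right
are small relative to it.

Lower bound on the Gram matrix. Contexts are truncated at radius `L` and rescaled to the unit ball,
giving vectors `z_s`. With `S = ∑ z_s z_sᵀ`, the potential `tr exp(-S)` starts at `d`. By
Golden–Thompson (`Matrix.trace_exp_add_le`) and the explicit exponential of a rank-one matrix, a new
vector `z` lowers it by at least `3/5 tr(exp(-S) z zᵀ)`. Conditionally on the history the diversity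
condition makes this a fixed fraction `3λ/(10 L²)` of the potential, provided that the conditional
mass lost by truncation is at most `λ/2`. The potential thus decays geometrically in mean, and
Markov's inequality bounds the least eigenvalue (`measureReal_not_sum_inner_sq_ge_le`). The
truncation losses are controlled by a moment of order about `log(dKT)` of the sub-exponential
contexts, with a union over the `K` arms.

Noise. For fixed `v`, `exp(∑ (e_s ⟨x_s, v⟩ - σ²/2 ⟨x_s, v⟩²))` has expectation at most `1`. If `‖E‖`
exceeded the claimed bound `r`, this exponent would be large at the multiple of `E` of length `r /
σ²`, and, when the contexts have norm at most `L`, still large at a nearby point of a fine grid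
(`exists_le_selfNormExponent_of_norm_gt`). A union bound over the polynomially many values of each
grid coordinate excludes this.

Four events of probability at most `T⁻²` are discarded: a chosen context outside the ball, a large
conditional truncation loss, a large potential, and a large exponent on the grid. The burn-in
condition makes each of the bounds small. -/

theorem norm_pow_sub_pow_le_mul {x y : 𝔸} {M : ℝ} (hM : 1 ≤ M) (hx : ‖x‖ ≤ M) (hy : ‖y‖ ≤ M)
    (n : ℕ) : ‖x ^ n - y ^ n‖ ≤ n * M ^ n * ‖x - y‖ := by
  induction n with
  | zero => simp
  | succ n ih =>
    have h1 : x ^ (n + 1) - y ^ (n + 1) = x ^ n * (x - y) + (x ^ n - y ^ n) * y := by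
      rw [pow_succ, pow_succ]; noncomm_ring
    have h2 : ‖x ^ n‖ ≤ M ^ n := (norm_pow_le x n).trans (by gcongr)
    have hMn : M ^ n ≤ M ^ (n + 1) := pow_le_pow_right₀ hM (Nat.le_succ n)
    calc ‖x ^ (n + 1) - y ^ (n + 1)‖ ≤ ‖x ^ n‖ * ‖x - y‖ + ‖x ^ n - y ^ n‖ * ‖y‖ := by
          rw [h1]
          exact (norm_add_le _ _).trans (add_le_add (norm_mul_le _ _) (norm_mul_le _ _))
      _ ≤ M ^ n * ‖x - y‖ + n * M ^ n * ‖x - y‖ * M := by gcongr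
      _ = M ^ n * ‖x - y‖ + n * M ^ (n + 1) * ‖x - y‖ := by ring
      _ ≤ M ^ (n + 1) * ‖x - y‖ + n * M ^ (n + 1) * ‖x - y‖ := by gcongr
      _ = _ := by push_cast; ring

variable [NormedAlgebra ℝ 𝔸]

theorem eventually_norm_le_of_hasDerivAt_zero {f : ℝ → 𝔸} {D : 𝔸} (hf : HasDerivAt f D 0)
    (hf0 : f 0 = 1) : ∀ᶠ h in 𝓝 (0 : ℝ), ‖f h‖ ≤ 1 + (‖D‖ + 1) * |h| := by
  have h1 := hasDerivAt_iff_isLittleO.1 hf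
  filter_upwards [h1.def zero_lt_one] with h hh
  simp only [sub_zero, hf0, Real.norm_eq_abs, one_mul] at hh
  calc ‖f h‖ = ‖1 + h • D + (f h - 1 - h • D)‖ := by congr 1; abel
    _ ≤ ‖(1 : 𝔸)‖ + ‖h • D‖ + ‖f h - 1 - h • D‖ := norm_add₃_le
    _ ≤ 1 + |h| * ‖D‖ + |h| := by
        rw [norm_one, norm_smul, Real.norm_eq_abs]; gcongr
    _ = _ := by ring

/-- Equal first-order behaviour gives `f(1/n) - g(1/n) = o(1/n)`. Telescoping the `n`-th powers
costs a factor `n (1 + C/n)^n ≤ n e^C`, which the `o(1/n)` absorbs. -/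
theorem tendsto_pow_sub_pow_of_hasDerivAt {f g : ℝ → 𝔸} {D : 𝔸} (hf : HasDerivAt f D 0)
    (hg : HasDerivAt g D 0) (hf0 : f 0 = 1) (hg0 : g 0 = 1) :
    Tendsto (fun n : ℕ => f (n : ℝ)⁻¹ ^ n - g (n : ℝ)⁻¹ ^ n) atTop (𝓝 0) := by
  have hinv : Tendsto (fun n : ℕ => (n : ℝ)⁻¹) atTop (𝓝 0) := tendsto_inv_atTop_nhds_zero_nat
  have hd : (fun h => f h - g h) =o[𝓝 0] fun h : ℝ => h := by
    have := hasDerivAt_iff_isLittleO.1 (hf.sub hg)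
    simpa [hf0, hg0] using this
  set C : ℝ := ‖D‖ + 1
  rw [tendsto_zero_iff_norm_tendsto_zero, Metric.tendsto_atTop]
  intro ε hε
  have hC : 0 < Real.exp C := Real.exp_pos C
  have e1 := hinv.eventually (hd.def (show 0 < ε / 2 / Real.exp C by positivity))
  have e2 := hinv.eventually (eventually_norm_le_of_hasDerivAt_zero hf hf0)
  have e3 := hinv.eventually (eventually_norm_le_of_hasDerivAt_zero hg hg0)
  obtain ⟨N, hN⟩ := eventually_atTop.1 ((e1.and (e2.and e3)).and (eventually_ge_atTop 1))
  refine ⟨N, fun n hn => ?_⟩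
  obtain ⟨⟨h1, h2, h3⟩, hn1⟩ := hN n hn
  have hn0 : (0 : ℝ) < n := by exact_mod_cast hn1
  have hCn : (0 : ℝ) ≤ C * (n : ℝ)⁻¹ := by positivity
  rw [abs_of_pos (by positivity)] at h2 h3
  have hpow : (1 + C * (n : ℝ)⁻¹) ^ n ≤ Real.exp C := by
    calc (1 + C * (n : ℝ)⁻¹) ^ n ≤ Real.exp (C * (n : ℝ)⁻¹) ^ n := by
          gcongr; linarith [Real.add_one_le_exp (C * (n : ℝ)⁻¹)]
      _ = Real.exp C := by rw [← Real.exp_nat_mul]; congr 1; field_simp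
  have key := norm_pow_sub_pow_le_mul (by linarith) h2 h3 n
  rw [dist_zero_right, norm_norm]
  rw [Real.norm_eq_abs, abs_of_pos (by positivity)] at h1
  calc _ ≤ _ := key
    _ ≤ n * Real.exp C * (ε / 2 / Real.exp C * (n : ℝ)⁻¹) := by gcongr
    _ = ε / 2 := by field_simp
    _ < ε := by linarith

theorem tendsto_exp_smul_mul_exp_smul_pow [CompleteSpace 𝔸] (A B : 𝔸) :
    Tendsto (fun n : ℕ => (NormedSpace.exp ((n : ℝ)⁻¹ • A) * NormedSpace.exp ((n : ℝ)⁻¹ • B)) ^ n)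
      atTop (𝓝 (NormedSpace.exp (A + B))) := by
  let : NormedAlgebra ℚ 𝔸 := NormedAlgebra.restrictScalars ℚ ℝ 𝔸
  have hA := hasDerivAt_exp_smul_const (𝕂 := ℝ) A 0
  have hB := hasDerivAt_exp_smul_const (𝕂 := ℝ) B 0
  have hAB := hasDerivAt_exp_smul_const (𝕂 := ℝ) (A + B) 0
  have hm := hA.mul hB
  simp only [zero_smul, NormedSpace.exp_zero, one_mul, mul_one] at hm hAB
  have h := tendsto_pow_sub_pow_of_hasDerivAt hm hAB (by simp) (by simp)
  have h2 := h.add_const (NormedSpace.exp (A + B))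
  rw [zero_add] at h2
  refine h2.congr' ?_
  filter_upwards [eventually_ge_atTop 1] with n hn
  have hn0 : (n : ℝ) ≠ 0 := by positivity
  have : NormedSpace.exp ((n : ℝ)⁻¹ • (A + B)) ^ n = NormedSpace.exp (A + B) := by
    rw [← NormedSpace.exp_nsmul, ← Nat.cast_smul_eq_nsmul ℝ, smul_smul, mul_inv_cancel₀ hn0,
      one_smul]
  simp only [Pi.mul_apply, this]
  abel

end LieTrotter

namespace Matrix

variable {n : Type*} [Fintype n]

/-- Cauchy–Schwarz for the Frobenius inner product. -/
theorem trace_mul_sq_le (A B : Matrix n n ℝ) :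
    (A * B).trace ^ 2 ≤ (A * Aᵀ).trace * (Bᵀ * B).trace := by
  have h := Finset.sum_mul_sq_le_sq_mul_sq (Finset.univ : Finset (n × n))
    (fun p => A p.1 p.2) (fun p => B p.2 p.1)
  simp only [Fintype.sum_prod_type] at h
  have e1 : (A * B).trace = ∑ i, ∑ j, A i j * B j i := by simp [trace, mul_apply]
  have e2 : (A * Aᵀ).trace = ∑ i, ∑ j, A i j ^ 2 := by simp [trace, mul_apply, sq]
  have e3 : (Bᵀ * B).trace = ∑ i, ∑ j, B j i ^ 2 := by simp [trace, mul_apply, sq]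
  rw [e1, e2, e3]
  exact h

variable [DecidableEq n]

theorem trace_mul_pow_comm (A B : Matrix n n ℝ) (k : ℕ) :
    ((A * B) ^ k).trace = ((B * A) ^ k).trace := by
  cases k with
  | zero => simp
  | succ k =>
    have : A * (B * A) ^ k = (A * B) ^ k * A := by
      induction k with
      | zero => simp
      | succ k ih =>
        rw [pow_succ, ← mul_assoc, ih, pow_succ]; simp only [mul_assoc]
    rw [pow_succ (B * A), ← mul_assoc, trace_mul_comm _ A, ← mul_assoc, this, mul_assoc, ← pow_succ]

/-- The two claims are proved by a joint induction on `k`. The first at `k + 1` comes from the first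
at `k` for `M²`, the second for `M Mᵀ` and `Mᵀ M`, and Cauchy–Schwarz, the powers of `M Mᵀ` and `Mᵀ
M` having equal traces. The second at `k + 1` comes from the first for `P Q` and then the second for
`Q²` and `P²`; cyclicity of the trace does the rest. -/
theorem abs_trace_pow_le_and_trace_mul_pow_le (k : ℕ) :
    (∀ M : Matrix n n ℝ, |(M ^ 2 ^ (k + 1)).trace| ≤ ((M * Mᵀ) ^ 2 ^ k).trace) ∧
    ∀ P Q : Matrix n n ℝ, P.IsSymm → Q.IsSymm →
      ((P * Q) ^ 2 ^ k).trace ≤ (P ^ 2 ^ k * Q ^ 2 ^ k).trace := by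
  induction k with
  | zero =>
    refine ⟨fun M => ?_, fun P Q _ _ => by simp⟩
    have h0 : 0 ≤ (M * Mᵀ).trace := by
      simpa using (posSemidef_self_mul_conjTranspose M).trace_nonneg
    have h := trace_mul_sq_le M M
    rw [trace_mul_comm Mᵀ M] at h
    have h' : (M ^ 2).trace ^ 2 ≤ (M * Mᵀ).trace ^ 2 := by rw [sq M]; simpa [sq] using h
    simpa using abs_le_of_sq_le_sq h' h0
  | succ k ih =>
    obtain ⟨hS, hT⟩ := ih
    refine ⟨fun M => ?_, fun P Q hP hQ => ?_⟩
    · have h1 := hS (M ^ 2)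
      rw [← pow_mul, ← pow_succ', transpose_pow] at h1
      refine h1.trans ?_
      have e1 : M ^ 2 * Mᵀ ^ 2 = M * (M * Mᵀ * Mᵀ) := by simp only [sq, mul_assoc]
      have e2 : M * Mᵀ * Mᵀ * M = (M * Mᵀ) * (Mᵀ * M) := by simp only [mul_assoc]
      rw [e1, trace_mul_pow_comm, e2]
      set P := M * Mᵀ with hPdef
      set Q := Mᵀ * M with hQdef
      have hP : P.IsSymm := by simp [IsSymm, hPdef]
      have hQ : Q.IsSymm := by simp [IsSymm, hQdef]
      refine (hT P Q hP hQ).trans ?_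
      have h2 := trace_mul_sq_le (P ^ 2 ^ k) (Q ^ 2 ^ k)
      rw [transpose_pow, transpose_pow, hP.eq, hQ.eq, ← pow_add, ← pow_add, ← two_mul,
        ← pow_succ', hQdef, ← trace_mul_pow_comm M, ← hPdef, ← sq] at h2
      have h0 : 0 ≤ (P ^ 2 ^ (k + 1)).trace := by
        have : P.PosSemidef := by simpa using posSemidef_self_mul_conjTranspose M
        exact (this.pow _).trace_nonneg
      exact (le_abs_self _).trans (abs_le_of_sq_le_sq h2 h0)
    · have h1 := (le_abs_self _).trans (hS (P * Q))
      refine h1.trans ?_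
      have e1 : (P * Q) * (P * Q)ᵀ = P * (Q * Q * P) := by
        rw [transpose_mul, hP.eq, hQ.eq]; simp only [mul_assoc]
      have e2 : Q * Q * P * P = Q ^ 2 * P ^ 2 := by simp only [sq, mul_assoc]
      rw [e1, trace_mul_pow_comm, e2]
      refine (hT (Q ^ 2) (P ^ 2) (hQ.pow 2) (hP.pow 2)).trans (le_of_eq ?_)
      rw [← pow_mul, ← pow_mul, ← pow_succ', trace_mul_comm]

/-- The **Golden–Thompson inequality** for real symmetric matrices. -/
theorem trace_exp_add_le {A B : Matrix n n ℝ} (hA : A.IsSymm) (hB : B.IsSymm) :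
    (NormedSpace.exp (A + B)).trace ≤ (NormedSpace.exp A * NormedSpace.exp B).trace := by
  -- With an empty index type the matrix ring is trivial and `‖1‖ = 1` fails, so the Lie–Trotter
  -- limit needs the nonempty case. The limit is then taken along `2 ^ k`, where the power-trace
  -- inequality is available.
  cases isEmpty_or_nonempty n with
  | inl h => simp [trace]
  | inr h =>
  let : NormedRing (Matrix n n ℝ) := Matrix.linftyOpNormedRing
  let : NormedAlgebra ℝ (Matrix n n ℝ) := Matrix.linftyOpNormedAlgebra
  have : NormOneClass (Matrix n n ℝ) := Matrix.linfty_opNormOneClass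
  have h1 := tendsto_exp_smul_mul_exp_smul_pow A B
  have h2 : Filter.Tendsto (fun k : ℕ => 2 ^ k) Filter.atTop Filter.atTop :=
    tendsto_pow_atTop_atTop_of_one_lt one_lt_two
  have h3 := h1.comp h2
  have hc : Continuous (fun M : Matrix n n ℝ => M.trace) := continuous_id.matrix_trace
  have h4 := (hc.tendsto _).comp h3
  refine le_of_tendsto h4 (Filter.Eventually.of_forall fun k => ?_)
  have h5 := (abs_trace_pow_le_and_trace_mul_pow_le (n := n) k).2
    (NormedSpace.exp (((2 ^ k : ℕ) : ℝ)⁻¹ • A)) (NormedSpace.exp (((2 ^ k : ℕ) : ℝ)⁻¹ • B))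
    ((hA.smul _).exp) ((hB.smul _).exp)
  refine h5.trans (le_of_eq ?_)
  have hk : ((2 ^ k : ℕ) : ℝ) ≠ 0 := by positivity
  rw [← exp_nsmul, ← exp_nsmul, ← Nat.cast_smul_eq_nsmul ℝ, ← Nat.cast_smul_eq_nsmul ℝ, smul_smul,
    smul_smul, mul_inv_cancel₀ hk, one_smul, one_smul]

end Matrix

/-! ### Rank-one updates of the trace of a matrix exponential. -/

namespace Matrix

variable {n : Type*} [Fintype n]

theorem trace_mul_vecMulVec (M : Matrix n n ℝ) (z : n → ℝ) :
    (M * vecMulVec z z).trace = ∑ j, ∑ k, M j k * (z j * z k) := by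
  simp only [trace, diag, mul_apply, vecMulVec_apply]
  exact Finset.sum_congr rfl fun j _ => Finset.sum_congr rfl fun k _ => by ring

theorem trace_mul_vecMulVec_nonneg {M : Matrix n n ℝ} (hM : M.PosSemidef) (z : n → ℝ) :
    0 ≤ (M * vecMulVec z z).trace := by
  rw [mul_vecMulVec, trace_vecMulVec, dotProduct_comm]
  simpa using hM.dotProduct_mulVec_nonneg z

/-- Positivity of the form at `e_j ± e_k` bounds the entry by the mean of two diagonal entries. It
bounds all entries of `exp(-S)`, which makes the products with integrable functions integrable later
on. -/
theorem abs_apply_le_trace_of_posSemidef {M : Matrix n n ℝ} (hM : M.PosSemidef) (j k : n) :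
    |M j k| ≤ M.trace := by
  classical
  have hd : ∀ i, M i i ≤ M.trace := fun i =>
    Finset.single_le_sum (f := fun i => M i i) (fun i _ => hM.diag_nonneg) (Finset.mem_univ i)
  have hsym : M k j = M j k := by simpa using hM.1.apply j k
  have h1 := hM.dotProduct_mulVec_nonneg (Pi.single j 1 + Pi.single k 1)
  have h2 := hM.dotProduct_mulVec_nonneg (Pi.single j 1 - Pi.single k 1)
  simp only [star_trivial, mulVec_add, mulVec_sub, mulVec_single_one, add_dotProduct,
    sub_dotProduct, dotProduct_add, dotProduct_sub, single_one_dotProduct, col_apply, hsym] at h1 h2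
  rw [abs_le]
  constructor <;> linarith [hd j, hd k]

variable [DecidableEq n]

/-- All powers `P^k` with `k ≥ 1` equal `P`, so the exponential series is that of `e^c` times `P`,
corrected by `1 - P` at `k = 0`. -/
theorem exp_smul_of_isIdempotentElem {P : Matrix n n ℝ} (hP : IsIdempotentElem P) (c : ℝ) :
    NormedSpace.exp (c • P) = 1 + (Real.exp c - 1) • P := by
  let _ : NormedRing (Matrix n n ℝ) := Matrix.linftyOpNormedRing
  let _ : NormedAlgebra ℝ (Matrix n n ℝ) := Matrix.linftyOpNormedAlgebra
  let _ : NormedAlgebra ℚ (Matrix n n ℝ) := NormedAlgebra.restrictScalars ℚ ℝ _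
  have h1 := NormedSpace.exp_series_hasSum_exp' (𝕂 := ℝ) (c • P)
  have h2 : HasSum (fun k : ℕ => ((k.factorial : ℝ)⁻¹ * c ^ k) • P) (Real.exp c • P) := by
    have := NormedSpace.exp_series_hasSum_exp' (𝕂 := ℝ) c
    rw [← Real.exp_eq_exp_ℝ] at this
    simpa using this.smul_const P
  have h3 := h2.add (hasSum_ite_eq (0 : ℕ) (1 - P))
  refine (h1.unique (h3.congr_fun ?_)).trans ?_
  · intro k
    cases k with
    | zero => simp
    | succ k => rw [smul_pow, hP.pow_succ_eq, smul_smul]; simp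
  · rw [sub_smul, one_smul]; abel

theorem exp_neg_vecMulVec_self {z : n → ℝ} (hz : z ⬝ᵥ z ≠ 0) :
    NormedSpace.exp (-vecMulVec z z) =
      1 - ((1 - Real.exp (-(z ⬝ᵥ z))) / (z ⬝ᵥ z)) • vecMulVec z z := by
  have hP : IsIdempotentElem ((z ⬝ᵥ z)⁻¹ • vecMulVec z z) := by
    unfold IsIdempotentElem
    rw [smul_mul_smul_comm, vecMulVec_mul_vecMulVec, vecMulVec_smul, smul_smul]
    congr 1
    field_simp
  have h := exp_smul_of_isIdempotentElem hP (-(z ⬝ᵥ z))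
  rw [smul_smul, neg_mul, mul_inv_cancel₀ hz, neg_one_smul, smul_smul] at h
  rw [h, sub_eq_add_neg (1 : Matrix n n ℝ), ← neg_smul]
  congr 2
  field_simp
  ring

/-- The chord of the convex function `exp` over `[-1, 0]` lies above it, and `e⁻¹ ≤ 2/5`. This is
the source of the factor `3/5`. -/
theorem exp_neg_le_one_sub_mul {r : ℝ} (h0 : 0 ≤ r) (h1 : r ≤ 1) :
    Real.exp (-r) ≤ 1 - 3 / 5 * r := by
  have h := convexOn_exp.2 (Set.mem_univ (-1)) (Set.mem_univ 0) h0 (sub_nonneg.2 h1) (by ring)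
  simp only [smul_eq_mul, mul_neg, mul_one, mul_zero, add_zero, Real.exp_zero] at h
  have h2 : Real.exp (-1) ≤ 2 / 5 := by
    rw [Real.exp_neg, inv_le_comm₀ (Real.exp_pos _) (by norm_num)]
    linarith [Real.exp_one_gt_d9]
  nlinarith

theorem exp_eq_mul_transpose {S : Matrix n n ℝ} (hS : S.IsSymm) :
    NormedSpace.exp S =
      NormedSpace.exp ((2 : ℝ)⁻¹ • S) * (NormedSpace.exp ((2 : ℝ)⁻¹ • S))ᵀ := by
  rw [((hS.smul _).exp).eq, ← exp_add_of_commute _ _ (Commute.refl _), ← add_smul]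
  norm_num

theorem posSemidef_exp {S : Matrix n n ℝ} (hS : S.IsSymm) : (NormedSpace.exp S).PosSemidef := by
  rw [exp_eq_mul_transpose hS]
  simpa using posSemidef_self_mul_conjTranspose (NormedSpace.exp ((2 : ℝ)⁻¹ • S))

/-- Since `exp S = N Nᵀ` with `N = exp(S/2)`, conjugating `C - lam • 1` by `N` keeps it positive
semidefinite, so the trace is nonnegative. -/
theorem le_trace_exp_mul {S C : Matrix n n ℝ} (hS : S.IsSymm) {lam : ℝ}
    (hC : (C - lam • (1 : Matrix n n ℝ)).PosSemidef) :
    lam * (NormedSpace.exp S).trace ≤ (NormedSpace.exp S * C).trace := by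
  set N := NormedSpace.exp ((2 : ℝ)⁻¹ • S) with hN
  have h := (hC.conjTranspose_mul_mul_same N).trace_nonneg
  rw [conjTranspose_eq_transpose_of_trivial, trace_mul_comm, ← mul_assoc, hN,
    ← exp_eq_mul_transpose hS, mul_sub, trace_sub, mul_smul_comm, trace_smul, mul_one, smul_eq_mul] at h
  linarith

theorem trace_exp_mul_vecMulVec_le {S : Matrix n n ℝ} (hS : S.IsSymm) (z : n → ℝ) :
    (NormedSpace.exp S * vecMulVec z z).trace ≤ (z ⬝ᵥ z) * (NormedSpace.exp S).trace := by
  -- Cauchy–Schwarz says `z zᵀ ⪯ |z|² I`; negated, it has the shape required by `le_trace_exp_mul`.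
  have hC : (-vecMulVec z z - (-(z ⬝ᵥ z)) • (1 : Matrix n n ℝ)).PosSemidef := by
    refine PosSemidef.of_dotProduct_mulVec_nonneg ?_ fun u => ?_
    · have h1 : (vecMulVec z z).IsSymm := transpose_vecMulVec z z
      exact h1.neg.sub (isSymm_one.smul _)
    · have h := Finset.sum_mul_sq_le_sq_mul_sq Finset.univ u z
      have e : star u ⬝ᵥ (-vecMulVec z z - (-(z ⬝ᵥ z)) • (1 : Matrix n n ℝ)) *ᵥ u =
          (u ⬝ᵥ u) * (z ⬝ᵥ z) - (u ⬝ᵥ z) ^ 2 := by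
        simp only [star_trivial, neg_smul, sub_neg_eq_add, add_mulVec, neg_mulVec, smul_mulVec,
          one_mulVec, vecMulVec_mulVec, dotProduct_add, dotProduct_neg, dotProduct_smul,
          smul_eq_mul, op_smul_eq_smul]
        rw [dotProduct_comm z u]
        ring
      rw [e]
      simp only [dotProduct, ← sq]
      linarith
  have h := le_trace_exp_mul hS hC
  rw [mul_neg, trace_neg] at h
  linarith

/-- Adding a rank-one matrix decreases `tr exp(-S)` by a definite amount. -/
theorem trace_exp_neg_add_vecMulVec_le {S : Matrix n n ℝ} (hS : S.IsSymm) {z : n → ℝ}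
    (hz : z ⬝ᵥ z ≤ 1) :
    (NormedSpace.exp (-(S + vecMulVec z z))).trace ≤ (NormedSpace.exp (-S)).trace -
      3 / 5 * (NormedSpace.exp (-S) * vecMulVec z z).trace := by
  have hz0 : 0 ≤ z ⬝ᵥ z := by simpa using dotProduct_star_self_nonneg z
  rcases hz0.eq_or_lt with h | h
  · have : z = 0 := by simpa using dotProduct_self_eq_zero.1 h.symm
    simp [this]
  have hV : (vecMulVec z z).IsSymm := transpose_vecMulVec z z
  rw [neg_add]
  refine (trace_exp_add_le hS.neg hV.neg).trans ?_
  rw [exp_neg_vecMulVec_self h.ne', mul_sub, mul_one, trace_sub, mul_smul_comm, trace_smul, smul_eq_mul]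
  have h1 := trace_mul_vecMulVec_nonneg (posSemidef_exp hS.neg) z
  have h2 : 3 / 5 ≤ (1 - Real.exp (-(z ⬝ᵥ z))) / (z ⬝ᵥ z) := by
    rw [le_div_iff₀ h]
    linarith [exp_neg_le_one_sub_mul hz0 hz]
  gcongr

/-- Each `exp(-D i)`, for an eigenvalue `D i` of `S`, is one nonnegative term of the trace, so every
eigenvalue is at least `b`. -/
theorem posSemidef_sub_of_trace_exp_neg_le {S : Matrix n n ℝ} (hS : S.IsSymm) {b : ℝ}
    (h : (NormedSpace.exp (-S)).trace ≤ Real.exp (-b)) :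
    (S - b • (1 : Matrix n n ℝ)).PosSemidef := by
  have hH : S.IsHermitian := hS
  have hspec := hH.spectral_theorem
  set U : Matrix n n ℝ := (hH.eigenvectorUnitary : Matrix n n ℝ) with hU
  set D : n → ℝ := hH.eigenvalues
  have hUU : U * star U = 1 := Unitary.coe_mul_star_self _
  have hUU' : star U * U = 1 := Unitary.coe_star_mul_self _
  have hS2 : S = U * diagonal D * star U := by
    simpa [Unitary.conjStarAlgAut_apply, Function.comp_def] using hspec
  have hinv : U⁻¹ = star U := inv_eq_right_inv hUU
  have hunit : IsUnit U := ⟨⟨U, star U, hUU, hUU'⟩, rfl⟩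
  have hexp : NormedSpace.exp (-S) = U * diagonal (fun i => Real.exp (-D i)) * star U := by
    rw [hS2, ← hinv, ← neg_mul, ← mul_neg, exp_conj _ _ hunit, diagonal_neg, exp_diagonal]
    congr 3
    ext i
    simp [Pi.coe_exp, Real.exp_eq_exp_ℝ]
  have htr : (NormedSpace.exp (-S)).trace = ∑ i, Real.exp (-D i) := by
    rw [hexp, mul_assoc, trace_mul_comm, mul_assoc, hUU', mul_one, trace_diagonal]
  have hD : ∀ i, b ≤ D i := by
    intro i
    have h1 : Real.exp (-D i) ≤ Real.exp (-b) := by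
      refine le_trans ?_ h
      rw [htr]
      exact Finset.single_le_sum (f := fun i => Real.exp (-D i))
        (fun i _ => (Real.exp_pos _).le) (Finset.mem_univ i)
    linarith [Real.exp_le_exp.1 h1]
  have : S - b • (1 : Matrix n n ℝ) = U * diagonal (fun i => D i - b) * Uᴴ := by
    have e : diagonal (fun i => D i - b) = diagonal D - b • (1 : Matrix n n ℝ) := by
      ext i j
      by_cases hij : i = j <;> simp [hij]
    rw [e, mul_sub, sub_mul, ← star_eq_conjTranspose, ← hS2, mul_smul_comm, mul_one, smul_mul_assoc, hUU]
  rw [this]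
  exact (PosSemidef.diagonal fun i => sub_nonneg.2 (hD i)).mul_mul_conjTranspose_same U

end Matrix

/-! ### A matrix Chernoff bound for adapted rank-one summands -/

theorem integral_mul_condExp_eq {Ω : Type*} {m m0 : MeasurableSpace Ω} {μ : Measure Ω}
    [IsFiniteMeasure μ] (hm : m ≤ m0) {f g : Ω → ℝ} (hf : Measurable[m] f) {C : ℝ}
    (hC : ∀ ω, |f ω| ≤ C) (hg : Integrable g μ) :
    ∫ ω, f ω * (μ[g | m]) ω ∂μ = ∫ ω, f ω * g ω ∂μ := by
  have hfg : Integrable (f * g) μ :=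
    hg.bdd_mul (c := C) (hf.mono hm le_rfl).aestronglyMeasurable (Filter.Eventually.of_forall hC)
  have h := condExp_mul_of_stronglyMeasurable_left hf.stronglyMeasurable hfg hg
  rw [← integral_condExp hm (f := fun ω => f ω * g ω)]
  exact (integral_congr_ae h).symm

theorem measurable_exp_neg_apply {Ω : Type*} {m : MeasurableSpace Ω} {d : ℕ}
    {S : Ω → Matrix (Fin d) (Fin d) ℝ} (hS : ∀ j k, Measurable fun ω => S ω j k) (j k : Fin d) :
    Measurable fun ω => NormedSpace.exp (-S ω) j k := by
  let _ : NormedRing (Matrix (Fin d) (Fin d) ℝ) := Matrix.linftyOpNormedRing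
  let _ : NormedAlgebra ℝ (Matrix (Fin d) (Fin d) ℝ) := Matrix.linftyOpNormedAlgebra
  let _ : NormedAlgebra ℚ (Matrix (Fin d) (Fin d) ℝ) := NormedAlgebra.restrictScalars ℚ ℝ _
  have h1 : Continuous fun M : Matrix (Fin d) (Fin d) ℝ => NormedSpace.exp (-M) :=
    NormedSpace.exp_continuous.comp continuous_neg
  have h2 : Continuous fun M : Fin d → Fin d → ℝ => NormedSpace.exp (-(Matrix.of M)) j k :=
    (continuous_apply_apply (ρ := fun _ _ => ℝ) j k).comp h1
  have h3 : Measurable fun ω => (fun j k => S ω j k : Fin d → Fin d → ℝ) :=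
    measurable_pi_lambda _ fun j => measurable_pi_lambda _ fun k => hS j k
  exact h2.measurable.comp h3

theorem integrable_mul_apply_of_sq {Ω : Type*} [MeasurableSpace Ω] {μ : Measure Ω} {d : ℕ}
    {x : Ω → Vec d} (hx : Measurable x) (hx2 : Integrable (fun ω => ‖x ω‖ ^ 2) μ) (j k : Fin d) :
    Integrable (fun ω => x ω j * x ω k) μ := by
  have hj : ∀ j, Measurable fun ω => x ω j := fun j => by fun_prop
  refine hx2.mono' ((hj j).mul (hj k)).aestronglyMeasurable (Filter.Eventually.of_forall fun ω => ?_)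
  rw [norm_mul, sq]
  exact mul_le_mul (PiLp.norm_apply_le _ _) (PiLp.norm_apply_le _ _) (norm_nonneg _) (norm_nonneg _)

/-- The part of a random vector inside the ball of radius `L`, rescaled to the unit ball. -/
noncomputable def rescaledTrunc {d : ℕ} (L : ℝ) (v : Vec d) : Vec d :=
  if ‖v‖ ≤ L then L⁻¹ • v else 0

/-- The squared norm outside the ball of radius `L`. -/
noncomputable def sqNormTail {d : ℕ} (L : ℝ) (v : Vec d) : ℝ :=
  if ‖v‖ ≤ L then 0 else ‖v‖ ^ 2

theorem norm_rescaledTrunc_le {d : ℕ} {L : ℝ} (hL : 0 < L) (v : Vec d) :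
    ‖rescaledTrunc L v‖ ≤ 1 := by
  unfold rescaledTrunc
  split_ifs with h
  · rw [norm_smul, norm_inv, Real.norm_of_nonneg hL.le, inv_mul_le_one₀ hL]; exact h
  · simp

theorem measurable_rescaledTrunc {d : ℕ} (L : ℝ) : Measurable (rescaledTrunc (d := d) L) :=
  Measurable.ite (measurableSet_le measurable_norm measurable_const) (by fun_prop) measurable_const

theorem measurable_sqNormTail {d : ℕ} (L : ℝ) : Measurable (sqNormTail (d := d) L) :=
  Measurable.ite (measurableSet_le measurable_norm measurable_const) measurable_const (by fun_prop)

theorem sqNormTail_nonneg {d : ℕ} (L : ℝ) (v : Vec d) : 0 ≤ sqNormTail L v := by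
  unfold sqNormTail; split_ifs <;> positivity

theorem sqNormTail_le {d : ℕ} (L : ℝ) (v : Vec d) : sqNormTail L v ≤ ‖v‖ ^ 2 := by
  unfold sqNormTail; split_ifs <;> [positivity; rfl]

theorem dotProduct_ofLp_self {d : ℕ} (v : Vec d) : v.ofLp ⬝ᵥ v.ofLp = ‖v‖ ^ 2 := by
  rw [EuclideanSpace.real_norm_sq_eq]; simp [dotProduct, sq]

open Matrix in
-- Inside the ball this is an equality; outside it, the truncated vector is `0` and the rank-one
-- trace is at most `‖v‖²` times the trace of the exponential.
theorem sq_mul_trace_exp_mul_rescaledTrunc_ge {d : ℕ} {L : ℝ} (hL : 0 < L)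
    {S : Matrix (Fin d) (Fin d) ℝ} (hS : S.IsSymm) (v : Vec d) :
    (NormedSpace.exp S * vecMulVec v.ofLp v.ofLp).trace -
        (NormedSpace.exp S).trace * sqNormTail L v ≤
      L ^ 2 * (NormedSpace.exp S *
        vecMulVec (rescaledTrunc L v).ofLp (rescaledTrunc L v).ofLp).trace := by
  unfold rescaledTrunc sqNormTail
  split_ifs with h
  · rw [mul_zero, sub_zero, WithLp.ofLp_smul, vecMulVec_smul, smul_vecMulVec, smul_smul,
      mul_smul_comm, trace_smul, smul_eq_mul, ← mul_assoc]
    refine le_of_eq ?_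
    field_simp
  · have := trace_exp_mul_vecMulVec_le hS v.ofLp
    rw [dotProduct_ofLp_self] at this
    simp
    linarith

open Matrix in
-- One round of the Chernoff argument. Both `exp(-S)` and the event `A` are known before the new
-- vector, so they pass through the conditional expectation. Diversity contributes `lam`, truncation
-- costs at most `lam / 2` on `A`, and `3/5 · 1/2 = 3/10`.
theorem setIntegral_trace_exp_neg_add_le {Ω : Type*} {m m0 : MeasurableSpace Ω} {μ : Measure Ω}
    [IsFiniteMeasure μ] (hm : m ≤ m0) {d : ℕ} {S : Ω → Matrix (Fin d) (Fin d) ℝ}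
    (hSm : ∀ j k, Measurable[m] fun ω => S ω j k) (hS : ∀ ω, (S ω).IsSymm)
    (htr : ∀ ω, (NormedSpace.exp (-S ω)).trace ≤ d) {x : Ω → Vec d} (hx : Measurable x)
    (hx2 : Integrable (fun ω => ‖x ω‖ ^ 2) μ) {lam L : ℝ} (hL : 0 < L)
    (hdiv : ∀ᵐ ω ∂μ, (condSecondMoment μ m x ω - lam • (1 : Matrix (Fin d) (Fin d) ℝ)).PosSemidef)
    {A : Set Ω} (hA : MeasurableSet[m] A)
    (hAρ : ∀ ω ∈ A, (μ[fun ω => sqNormTail L (x ω) | m]) ω ≤ lam / 2) :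
    ∫ ω in A, (NormedSpace.exp (-(S ω + vecMulVec (rescaledTrunc L (x ω)).ofLp
        (rescaledTrunc L (x ω)).ofLp))).trace ∂μ ≤
      (1 - 3 / 10 * (lam / L ^ 2)) * ∫ ω in A, (NormedSpace.exp (-S ω)).trace ∂μ := by
  set M : Ω → Matrix (Fin d) (Fin d) ℝ := fun ω => NormedSpace.exp (-S ω) with hMdef
  set z : Ω → Vec d := fun ω => rescaledTrunc L (x ω) with hzdef
  set τ : Ω → ℝ := fun ω => sqNormTail L (x ω) with hτdef
  have hA0 : MeasurableSet[m0] A := hm _ hA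
  have hMm : ∀ j k, Measurable[m] fun ω => M ω j k := measurable_exp_neg_apply hSm
  have hMpsd : ∀ ω, (M ω).PosSemidef := fun ω => posSemidef_exp (hS ω).neg
  have htrm : Measurable[m] fun ω => (M ω).trace :=
    Finset.measurable_sum _ fun i _ => hMm i i
  have htr0 : ∀ ω, 0 ≤ (M ω).trace := fun ω => (hMpsd ω).trace_nonneg
  have hMb : ∀ j k ω, |M ω j k| ≤ d := fun j k ω =>
    (abs_apply_le_trace_of_posSemidef (hMpsd ω) j k).trans (htr ω)
  have htrb : ∀ ω, |(M ω).trace| ≤ d := fun ω => by rw [abs_of_nonneg (htr0 ω)]; exact htr ω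
  have hzm : Measurable z := (measurable_rescaledTrunc L).comp hx
  have hτi : Integrable τ μ :=
    hx2.mono' ((measurable_sqNormTail L).comp hx).aestronglyMeasurable
      (Filter.Eventually.of_forall fun ω => by
        rw [Real.norm_of_nonneg (sqNormTail_nonneg _ _)]; exact sqNormTail_le _ _)
  have hxx := integrable_mul_apply_of_sq hx hx2
  have hz2 : Integrable (fun ω => ‖z ω‖ ^ 2) μ := by
    refine (integrable_const (1 : ℝ)).mono' (by fun_prop) (Filter.Eventually.of_forall fun ω => ?_)
    rw [Real.norm_of_nonneg (by positivity)]
    exact pow_le_one₀ (norm_nonneg _) (norm_rescaledTrunc_le hL _)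
  have hzz := integrable_mul_apply_of_sq hzm hz2
  have hbdd : ∀ {f g : Ω → ℝ}, Measurable[m] f → (∀ ω, |f ω| ≤ d) → Integrable g μ →
      Integrable (fun ω => f ω * g ω) μ := fun hf hb hg =>
    hg.bdd_mul (c := d) (hf.mono hm le_rfl).aestronglyMeasurable (Filter.Eventually.of_forall hb)
  have htri : Integrable (fun ω => (M ω).trace) μ := by
    simpa using hbdd htrm htrb (integrable_const (1 : ℝ))
  have hpull : ∀ {f g : Ω → ℝ}, Measurable[m] f → (∀ ω, |f ω| ≤ d) → Integrable g μ →
      ∫ ω in A, f ω * (μ[g | m]) ω ∂μ = ∫ ω in A, f ω * g ω ∂μ := by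
    -- The indicator of `A` is absorbed into the `m`-measurable factor.
    intro f g hf hb hg
    have h := integral_mul_condExp_eq (μ := μ) hm (f := A.indicator f) (hf.indicator hA)
      (C := d) (fun ω => by
        by_cases h : ω ∈ A
        · simpa [h] using hb ω
        · simp [h]) hg
    rw [← integral_indicator hA0, ← integral_indicator hA0]
    simpa only [Set.indicator_mul_left] using h
  have hMx : Integrable (fun ω => (M ω * vecMulVec (x ω).ofLp (x ω).ofLp).trace) μ := by
    simp only [trace_mul_vecMulVec]
    exact integrable_finsetSum _ fun j _ => integrable_finsetSum _ fun k _ =>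
      hbdd (hMm j k) (hMb j k) (hxx j k)
  have hMz : Integrable (fun ω => (M ω * vecMulVec (z ω).ofLp (z ω).ofLp).trace) μ := by
    simp only [trace_mul_vecMulVec]
    exact integrable_finsetSum _ fun j _ => integrable_finsetSum _ fun k _ =>
      hbdd (hMm j k) (hMb j k) (hzz j k)
  have hMτ : Integrable (fun ω => (M ω).trace * τ ω) μ := hbdd htrm htrb hτi
  have e1 : lam * ∫ ω in A, (M ω).trace ∂μ ≤
      ∫ ω in A, (M ω * vecMulVec (x ω).ofLp (x ω).ofLp).trace ∂μ := by
    have e : ∫ ω in A, (M ω * vecMulVec (x ω).ofLp (x ω).ofLp).trace ∂μ =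
        ∫ ω in A, (M ω * condSecondMoment μ m x ω).trace ∂μ := by
      have hC : ∀ ω, (M ω * condSecondMoment μ m x ω).trace =
          ∑ j, ∑ k, M ω j k * (μ[fun ω' => x ω' k * x ω' j | m]) ω := by
        intro ω
        simp [trace, mul_apply, condSecondMoment]
      simp only [trace_mul_vecMulVec, hC]
      rw [integral_finsetSum _ fun j _ => (integrable_finsetSum _ fun k _ =>
        hbdd (hMm j k) (hMb j k) (hxx j k)).integrableOn, integral_finsetSum _ fun j _ =>
        (integrable_finsetSum _ fun k _ =>
          hbdd (hMm j k) (hMb j k) integrable_condExp).integrableOn]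
      refine Finset.sum_congr rfl fun j _ => ?_
      rw [integral_finsetSum _ fun k _ => (hbdd (hMm j k) (hMb j k) (hxx j k)).integrableOn,
        integral_finsetSum _ fun k _ =>
          (hbdd (hMm j k) (hMb j k) integrable_condExp).integrableOn]
      refine Finset.sum_congr rfl fun k _ => ?_
      rw [hpull (hMm j k) (hMb j k) (hxx k j)]
      simp only [mul_comm]
    have hCi : Integrable (fun ω => (M ω * condSecondMoment μ m x ω).trace) μ := by
      simp only [trace, diag, mul_apply, condSecondMoment, of_apply]
      exact integrable_finsetSum _ fun j _ => integrable_finsetSum _ fun k _ =>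
        hbdd (hMm j k) (hMb j k) integrable_condExp
    rw [e, ← integral_const_mul]
    refine setIntegral_mono_ae (htri.const_mul lam).integrableOn hCi.integrableOn ?_
    filter_upwards [hdiv] with ω hω using le_trace_exp_mul (hS ω).neg hω
  have e2 : ∫ ω in A, (M ω).trace * τ ω ∂μ ≤ lam / 2 * ∫ ω in A, (M ω).trace ∂μ := by
    rw [← hpull htrm htrb hτi, ← integral_const_mul]
    refine setIntegral_mono_on (hbdd htrm htrb integrable_condExp).integrableOn
      (htri.const_mul _).integrableOn hA0 fun ω hω => ?_
    rw [mul_comm]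
    exact mul_le_mul_of_nonneg_right (hAρ ω hω) (htr0 ω)
  have e3 : lam / 2 * ∫ ω in A, (M ω).trace ∂μ ≤
      L ^ 2 * ∫ ω in A, (M ω * vecMulVec (z ω).ofLp (z ω).ofLp).trace ∂μ := by
    have := setIntegral_mono (s := A) (hMx.sub hMτ).integrableOn (hMz.const_mul (L ^ 2)).integrableOn
      fun ω => sq_mul_trace_exp_mul_rescaledTrunc_ge hL (hS ω).neg (x ω)
    simp only [Pi.sub_apply] at this
    rw [integral_sub hMx.integrableOn hMτ.integrableOn, integral_const_mul] at this
    linarith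
  have hpt : ∀ ω, (NormedSpace.exp (-(S ω + vecMulVec (z ω).ofLp (z ω).ofLp))).trace ≤
      (M ω).trace - 3 / 5 * (M ω * vecMulVec (z ω).ofLp (z ω).ofLp).trace := fun ω =>
    trace_exp_neg_add_vecMulVec_le (hS ω) (by
      rw [dotProduct_ofLp_self]
      exact pow_le_one₀ (norm_nonneg _) (norm_rescaledTrunc_le hL _))
  have hsub : Integrable (fun ω => (M ω).trace -
      3 / 5 * (M ω * vecMulVec (z ω).ofLp (z ω).ofLp).trace) μ := htri.sub (hMz.const_mul _)
  have hle : ∫ ω in A, (NormedSpace.exp (-(S ω + vecMulVec (z ω).ofLp (z ω).ofLp))).trace ∂μ ≤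
      ∫ ω in A, ((M ω).trace - 3 / 5 * (M ω * vecMulVec (z ω).ofLp (z ω).ofLp).trace) ∂μ := by
    refine integral_mono_of_nonneg (Filter.Eventually.of_forall fun ω => ?_) hsub.integrableOn
      (Filter.Eventually.of_forall hpt)
    have hV : (vecMulVec (z ω).ofLp (z ω).ofLp).IsSymm := transpose_vecMulVec _ _
    exact (posSemidef_exp ((hS ω).add hV).neg).trace_nonneg
  rw [integral_sub htri.integrableOn (hMz.const_mul _).integrableOn, integral_const_mul] at hle
  have e4 : lam / L ^ 2 * ∫ ω in A, (M ω).trace ∂μ ≤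
      2 * ∫ ω in A, (M ω * vecMulVec (z ω).ofLp (z ω).ofLp).trace ∂μ := by
    rw [div_mul_eq_mul_div, div_le_iff₀ (by positivity)]
    linarith
  linarith

/-- The Gram matrix of the vectors truncated at radius `L` and rescaled. -/
noncomputable def truncGram {d : ℕ} (L : ℝ) (x : ℕ → Vec d) (t : ℕ) : Matrix (Fin d) (Fin d) ℝ :=
  gram (fun s => rescaledTrunc L (x s)) t

theorem gram_succ {d : ℕ} (x : ℕ → Vec d) (t : ℕ) :
    gram x (t + 1) = gram x t + Matrix.vecMulVec (x (t + 1)).ofLp (x (t + 1)).ofLp := by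
  unfold gram
  rw [Finset.sum_Icc_succ_top (by omega)]

theorem gram_isSymm {d : ℕ} (x : ℕ → Vec d) (t : ℕ) : (gram x t).IsSymm := by
  unfold gram Matrix.IsSymm
  rw [Matrix.transpose_sum]
  exact Finset.sum_congr rfl fun s _ => Matrix.transpose_vecMulVec _ _

theorem dotProduct_gram_mulVec {d : ℕ} (x : ℕ → Vec d) (t : ℕ) (u v : Vec d) :
    u.ofLp ⬝ᵥ (gram x t).mulVec v.ofLp =
      ∑ s ∈ Finset.Icc 1 t, inner ℝ (x s) u * inner ℝ (x s) v := by
  unfold gram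
  rw [Matrix.sum_mulVec, dotProduct_sum]
  refine Finset.sum_congr rfl fun s _ => ?_
  rw [Matrix.vecMulVec_mulVec, EuclideanSpace.inner_eq_star_dotProduct,
    EuclideanSpace.inner_eq_star_dotProduct]
  simp [dotProduct_comm]
  ring

section Chernoff

variable {Ω : Type*} {m0 : MeasurableSpace Ω} {μ : Measure Ω} [IsProbabilityMeasure μ] {d : ℕ}
  {ℋ : ℕ → MeasurableSpace Ω} {x : ℕ → Ω → Vec d} {T : ℕ} {lam L : ℝ}

open Matrix in
theorem trace_exp_neg_truncGram_le (hL : 0 < L) (x : ℕ → Vec d) (t : ℕ) :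
    (NormedSpace.exp (-truncGram L x t)).trace ≤ d := by
  induction t with
  | zero => simp [truncGram, _root_.gram]
  | succ t ih =>
    unfold truncGram at ih ⊢
    rw [gram_succ]
    refine (trace_exp_neg_add_vecMulVec_le (gram_isSymm _ t) ?_).trans ?_
    · rw [dotProduct_ofLp_self]
      exact pow_le_one₀ (norm_nonneg _) (norm_rescaledTrunc_le hL _)
    · have := trace_mul_vecMulVec_nonneg
        (posSemidef_exp (gram_isSymm (fun s => rescaledTrunc L (x s)) t).neg)
        (rescaledTrunc L (x (t + 1))).ofLp
      linarith

theorem measurable_gram_apply {m : MeasurableSpace Ω} {y : ℕ → Ω → Vec d} {t : ℕ}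
    (hy : ∀ s ∈ Finset.Icc 1 t, Measurable (y s)) (j k : Fin d) :
    Measurable fun ω => gram (fun s => y s ω) t j k := by
  unfold gram
  simp only [Matrix.sum_apply, Matrix.vecMulVec_apply]
  refine Finset.measurable_sum _ fun s hs => ?_
  have := hy s hs
  fun_prop

/-- The events shrink as `t` grows, and the one for `t + 1` is already `ℋ t`-measurable because it
only involves conditional expectations given earlier histories. Each round therefore multiplies the
restricted integral by the one-step factor. -/
theorem setIntegral_trace_exp_neg_truncGram_le (hmono : Monotone ℋ) (hle : ∀ s ≤ T, ℋ s ≤ m0)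
    (hx : ∀ s ∈ Finset.Icc 1 T, Measurable[ℋ s] (x s))
    (hx2 : ∀ s ∈ Finset.Icc 1 T, Integrable (fun ω => ‖x s ω‖ ^ 2) μ) (hL : 0 < L)
    (hdiv : ∀ s ∈ Finset.Icc 1 T, ∀ᵐ ω ∂μ,
      (condSecondMoment μ (ℋ (s - 1)) (x s) ω - lam • (1 : Matrix (Fin d) (Fin d) ℝ)).PosSemidef)
    (t : ℕ) (ht : t ≤ T) :
    ∫ ω in {ω | ∀ s ∈ Finset.Icc 1 t,
        (μ[fun ω => sqNormTail L (x s ω) | ℋ (s - 1)]) ω ≤ lam / 2},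
      (NormedSpace.exp (-truncGram L (fun s => x s ω) t)).trace ∂μ ≤
      d * Real.exp (-(3 / 10 * (lam / L ^ 2))) ^ t := by
  have hz : ∀ t ≤ T, ∀ s ∈ Finset.Icc 1 t, Measurable[ℋ t] fun ω => rescaledTrunc L (x s ω) :=
    fun t ht s hs => (measurable_rescaledTrunc L).comp
      ((hx s (Finset.Icc_subset_Icc_right ht hs)).mono (hmono (Finset.mem_Icc.1 hs).2) le_rfl)
  have htr0 : ∀ t ω, 0 ≤ (NormedSpace.exp (-truncGram L (fun s => x s ω) t)).trace :=
    fun t ω => (Matrix.posSemidef_exp (gram_isSymm _ t).neg).trace_nonneg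
  induction t with
  | zero => simp [truncGram, gram]
  | succ t ih =>
    have ih := ih (by omega)
    set A : ℕ → Set Ω := fun t => {ω | ∀ s ∈ Finset.Icc 1 t,
      (μ[fun ω => sqNormTail L (x s ω) | ℋ (s - 1)]) ω ≤ lam / 2} with hAdef
    have hmem : t + 1 ∈ Finset.Icc 1 T := Finset.mem_Icc.2 ⟨by omega, ht⟩
    have hA : MeasurableSet[ℋ t] (A (t + 1)) := by
      have : A (t + 1) = ⋂ s ∈ Finset.Icc 1 (t + 1),
          {ω | (μ[fun ω => sqNormTail L (x s ω) | ℋ (s - 1)]) ω ≤ lam / 2} := by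
        ext ω; simp [hAdef]
      rw [this]
      refine Finset.measurableSet_biInter _ fun s hs => ?_
      have hst : s - 1 ≤ t := by have := Finset.mem_Icc.1 hs; omega
      have h1 : Measurable[ℋ t] (μ[fun ω => sqNormTail L (x s ω) | ℋ (s - 1)]) :=
        stronglyMeasurable_condExp.measurable.mono (hmono hst) le_rfl
      exact measurableSet_le h1 measurable_const
    have hSm : ∀ j k, Measurable[ℋ t] fun ω => truncGram L (fun s => x s ω) t j k :=
      fun j k => measurable_gram_apply (m := ℋ t) (hz t (by omega)) j k
    have hxm : Measurable[m0] (x (t + 1)) := (hx _ hmem).mono (hle _ ht) le_rfl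
    have hdiv' := hdiv _ hmem
    rw [Nat.add_sub_cancel] at hdiv'
    have hAρ : ∀ ω ∈ A (t + 1), (μ[fun ω => sqNormTail L (x (t + 1) ω) | ℋ t]) ω ≤ lam / 2 :=
      fun ω hω => hω (t + 1) (Finset.mem_Icc.2 ⟨by omega, le_rfl⟩)
    have hstep := setIntegral_trace_exp_neg_add_le (μ := μ) (hle t (by omega)) hSm
      (fun ω => gram_isSymm _ t) (fun ω => trace_exp_neg_truncGram_le hL _ t) hxm
      (hx2 _ hmem) hL hdiv' hA hAρ
    have hsucc : ∀ ω, truncGram L (fun s => x s ω) (t + 1) = truncGram L (fun s => x s ω) t +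
        Matrix.vecMulVec (rescaledTrunc L (x (t + 1) ω)).ofLp
          (rescaledTrunc L (x (t + 1) ω)).ofLp := fun ω => gram_succ _ t
    simp only [hsucc]
    refine hstep.trans ?_
    have hmeas : Measurable[m0] fun ω =>
        (NormedSpace.exp (-truncGram L (fun s => x s ω) t)).trace :=
      (Finset.measurable_sum _ fun i _ => measurable_exp_neg_apply
        (m := ℋ t) (fun j k => measurable_gram_apply (hz t (by omega)) j k) i i).mono
        (hle t (by omega)) le_rfl
    have hint : Integrable (fun ω =>
        (NormedSpace.exp (-truncGram L (fun s => x s ω) t)).trace) μ :=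
      (integrable_const (d : ℝ)).mono' hmeas.aestronglyMeasurable
        (Filter.Eventually.of_forall fun ω => by
          rw [Real.norm_of_nonneg (htr0 t ω)]; exact trace_exp_neg_truncGram_le hL _ t)
    have hsub : ∫ ω in A (t + 1), (NormedSpace.exp (-truncGram L (fun s => x s ω) t)).trace ∂μ ≤
        ∫ ω in A t, (NormedSpace.exp (-truncGram L (fun s => x s ω) t)).trace ∂μ :=
      setIntegral_mono_set hint.integrableOn (Filter.Eventually.of_forall (htr0 t))
        (Filter.Eventually.of_forall fun ω hω s hs =>
          hω s (Finset.Icc_subset_Icc_right (Nat.le_succ t) hs))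
    have h0 : 0 ≤ ∫ ω in A (t + 1), (NormedSpace.exp (-truncGram L (fun s => x s ω) t)).trace ∂μ :=
      integral_nonneg (htr0 t)
    -- The factor `1 - 3/10 · lam / L²` might be negative, so it is replaced by an exponential
    -- before the induction hypothesis is multiplied by it.
    have hq : 1 - 3 / 10 * (lam / L ^ 2) ≤ Real.exp (-(3 / 10 * (lam / L ^ 2))) := by
      linarith [Real.add_one_le_exp (-(3 / 10 * (lam / L ^ 2)))]
    calc _ ≤ Real.exp (-(3 / 10 * (lam / L ^ 2))) *
          ∫ ω in A (t + 1), (NormedSpace.exp (-truncGram L (fun s => x s ω) t)).trace ∂μ :=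
          mul_le_mul_of_nonneg_right hq h0
      _ ≤ Real.exp (-(3 / 10 * (lam / L ^ 2))) *
          (d * Real.exp (-(3 / 10 * (lam / L ^ 2))) ^ t) := by
          gcongr; exact hsub.trans ih
      _ = _ := by ring

/-- Discarding the vectors outside the ball only lowers the quadratic form, and rescaling accounts
for `L ^ 2`. -/
theorem sum_inner_sq_ge_of_posSemidef_truncGram (hL : 0 < L) {x : ℕ → Vec d} {t : ℕ} {b : ℝ}
    (h : (truncGram L x t - b • (1 : Matrix (Fin d) (Fin d) ℝ)).PosSemidef) (u : Vec d) :
    b * L ^ 2 * ‖u‖ ^ 2 ≤ ∑ s ∈ Finset.Icc 1 t, inner ℝ (x s) u ^ 2 := by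
  have h1 := h.dotProduct_mulVec_nonneg u.ofLp
  rw [star_trivial, Matrix.sub_mulVec, dotProduct_sub, truncGram, dotProduct_gram_mulVec,
    Matrix.smul_mulVec, Matrix.one_mulVec, dotProduct_smul, dotProduct_ofLp_self, smul_eq_mul,
    sub_nonneg] at h1
  have h2 : ∑ s ∈ Finset.Icc 1 t, inner ℝ (rescaledTrunc L (x s)) u *
      inner ℝ (rescaledTrunc L (x s)) u ≤
      ∑ s ∈ Finset.Icc 1 t, (L ^ 2)⁻¹ * inner ℝ (x s) u ^ 2 := by
    refine Finset.sum_le_sum fun s _ => ?_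
    unfold rescaledTrunc
    split_ifs
    · rw [real_inner_smul_left]
      refine le_of_eq ?_
      field_simp
    · simp only [inner_zero_left, mul_zero]; positivity
  rw [← Finset.mul_sum] at h2
  have h3 := h1.trans h2
  rw [inv_mul_eq_div, le_div_iff₀ (by positivity)] at h3
  linarith

theorem measureReal_not_sum_inner_sq_ge_le (hmono : Monotone ℋ) (hle : ∀ s ≤ T, ℋ s ≤ m0)
    (hx : ∀ s ∈ Finset.Icc 1 T, Measurable[ℋ s] (x s))
    (hx2 : ∀ s ∈ Finset.Icc 1 T, Integrable (fun ω => ‖x s ω‖ ^ 2) μ) (hL : 0 < L)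
    (hlam : 0 < lam)
    (hdiv : ∀ s ∈ Finset.Icc 1 T, ∀ᵐ ω ∂μ,
      (condSecondMoment μ (ℋ (s - 1)) (x s) ω - lam • (1 : Matrix (Fin d) (Fin d) ℝ)).PosSemidef)
    {t : ℕ} (ht : t ≤ T) (b : ℝ) :
    μ.real {ω | ¬ ∀ u : Vec d,
        b * L ^ 2 * ‖u‖ ^ 2 ≤ ∑ s ∈ Finset.Icc 1 t, inner ℝ (x s ω) u ^ 2} ≤
      d * Real.exp (b - 3 / 10 * (lam / L ^ 2) * t) +
        ∑ s ∈ Finset.Icc 1 t, 2 / lam * ∫ ω, sqNormTail L (x s ω) ∂μ := by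
  set A : Set Ω := {ω | ∀ s ∈ Finset.Icc 1 t,
    (μ[fun ω => sqNormTail L (x s ω) | ℋ (s - 1)]) ω ≤ lam / 2} with hAdef
  set F : Ω → ℝ := fun ω => (NormedSpace.exp (-truncGram L (fun s => x s ω) t)).trace with hF
  have hF0 : ∀ ω, 0 ≤ F ω := fun ω => (Matrix.posSemidef_exp (gram_isSymm _ t).neg).trace_nonneg
  have hz : ∀ s ∈ Finset.Icc 1 t, Measurable[m0] fun ω => rescaledTrunc L (x s ω) :=
    fun s hs => (measurable_rescaledTrunc L).comp
      ((hx s (Finset.Icc_subset_Icc_right ht hs)).mono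
        (hle s ((Finset.mem_Icc.1 hs).2.trans ht)) le_rfl)
  have hFm : Measurable F := Finset.measurable_sum _ fun i _ => measurable_exp_neg_apply
    (fun j k => measurable_gram_apply hz j k) i i
  have hFi : Integrable F μ :=
    (integrable_const (d : ℝ)).mono' hFm.aestronglyMeasurable
      (Filter.Eventually.of_forall fun ω => by
        rw [Real.norm_of_nonneg (hF0 ω)]; exact trace_exp_neg_truncGram_le hL _ t)
  -- A bad outcome either has a large potential while all conditional truncation losses are small,
  -- or has some large loss. Markov's inequality handles each.
  have hsub : {ω | ¬ ∀ u : Vec d,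
      b * L ^ 2 * ‖u‖ ^ 2 ≤ ∑ s ∈ Finset.Icc 1 t, inner ℝ (x s ω) u ^ 2} ⊆
      ({ω | Real.exp (-b) ≤ F ω} ∩ A) ∪ ⋃ s ∈ Finset.Icc 1 t,
        {ω | lam / 2 ≤ (μ[fun ω => sqNormTail L (x s ω) | ℋ (s - 1)]) ω} := by
    intro ω hω
    by_cases hωA : ω ∈ A
    · refine Or.inl ⟨?_, hωA⟩
      by_contra hcon
      exact hω (sum_inner_sq_ge_of_posSemidef_truncGram hL
        (Matrix.posSemidef_sub_of_trace_exp_neg_le (gram_isSymm _ t) (not_le.1 hcon).le))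
    · right
      simp only [hAdef, Set.mem_ofPred_eq, not_forall, not_le] at hωA
      obtain ⟨s, hs, h⟩ := hωA
      exact Set.mem_biUnion hs h.le
  refine (measureReal_mono hsub).trans ((measureReal_union_le _ _).trans (add_le_add ?_ ?_))
  · have h1 := mul_meas_ge_le_integral_of_nonneg (μ := μ.restrict A)
      (Filter.Eventually.of_forall hF0) hFi.integrableOn (Real.exp (-b))
    rw [measureReal_restrict_apply (measurableSet_le measurable_const hFm)] at h1
    have h2 := h1.trans
      (setIntegral_trace_exp_neg_truncGram_le hmono hle hx hx2 hL hdiv t ht)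
    rw [← le_div_iff₀' (Real.exp_pos _), ← Real.exp_nat_mul] at h2
    refine h2.trans (le_of_eq ?_)
    rw [mul_div_assoc, ← Real.exp_sub]
    ring_nf
  · refine (measureReal_biUnion_finset_le _ _).trans (Finset.sum_le_sum fun s hs => ?_)
    have hs' := Finset.mem_Icc.1 hs
    have h1 := mul_meas_ge_le_integral_of_nonneg (μ := μ)
      (f := μ[fun ω => sqNormTail L (x s ω) | ℋ (s - 1)])
      (condExp_nonneg (Filter.Eventually.of_forall fun ω => sqNormTail_nonneg _ _))
      integrable_condExp (lam / 2)
    rw [integral_condExp (hle _ (by omega))] at h1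
    rw [div_mul_eq_mul_div, le_div_iff₀ hlam]
    linarith

end Chernoff

/-! ### Exponential moments with a predictable multiplier -/

section Noise

open Filter Topology

/-- `r` rounded towards zero to a multiple of `1 / n`, as a multiple of `1 / n`. -/
noncomputable def roundToZero (n : ℕ) (r : ℝ) : ℤ := if 0 ≤ r then ⌊n * r⌋ else ⌈n * r⌉

theorem measurable_roundToZero (n : ℕ) : Measurable (roundToZero n) :=
  Measurable.ite measurableSet_Ici (Int.measurable_floor.comp (measurable_const_mul _))
    (Int.measurable_ceil.comp (measurable_const_mul _))

theorem abs_roundToZero_div_le (n : ℕ) (r : ℝ) : |(roundToZero n r : ℝ) / n| ≤ |r| := by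
  rcases Nat.eq_zero_or_pos n with rfl | hn
  · simp
  have hn0 : (0 : ℝ) < n := by exact_mod_cast hn
  rw [abs_div, abs_of_pos hn0, div_le_iff₀ hn0]
  unfold roundToZero
  split_ifs with h
  · have h1 : 0 ≤ ⌊n * r⌋ := Int.floor_nonneg.2 (by positivity)
    rw [abs_of_nonneg h, abs_of_nonneg (by exact_mod_cast h1)]
    linarith [Int.floor_le (n * r)]
  · have hr : r < 0 := not_le.1 h
    have h1 : (⌈n * r⌉ : ℝ) ≤ 0 := by
      exact_mod_cast Int.ceil_le.2 (by push_cast; nlinarith)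
    rw [abs_of_neg hr, abs_of_nonpos h1]
    linarith [Int.le_ceil (n * r)]

theorem tendsto_roundToZero_div (r : ℝ) :
    Tendsto (fun n : ℕ => (roundToZero n r : ℝ) / n) atTop (𝓝 r) := by
  rw [tendsto_iff_norm_sub_tendsto_zero]
  refine squeeze_zero' (Eventually.of_forall fun n => norm_nonneg _) ?_
    (tendsto_inv_atTop_nhds_zero_nat (𝕜 := ℝ))
  filter_upwards [eventually_ge_atTop 1] with n hn
  have hn0 : (0 : ℝ) < n := by exact_mod_cast hn
  have h1 : |(roundToZero n r : ℝ) - n * r| ≤ 1 := by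
    unfold roundToZero
    split_ifs
    · rw [abs_le]; constructor <;> linarith [Int.floor_le (n * r), Int.lt_floor_add_one (n * r)]
    · rw [abs_le]; constructor <;> linarith [Int.le_ceil (n * r), Int.ceil_lt_add_one (n * r)]
  have h2 : (roundToZero n r : ℝ) / n - r = ((roundToZero n r : ℝ) - n * r) / n := by field_simp
  rw [h2, norm_div, Real.norm_eq_abs, Real.norm_of_nonneg hn0.le, ← one_div]
  gcongr

variable {Ω : Type*} {m m0 : MeasurableSpace Ω} {μ : Measure Ω} [IsProbabilityMeasure μ]
  {η : Ω → ℝ} {σ : ℝ}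

theorem setLIntegral_exp_const_mul_le (hm : m ≤ m0)
    (hint : ∀ l : ℝ, Integrable (fun ω => Real.exp (l * η ω)) μ)
    (hsub : ∀ l : ℝ, ∀ᵐ ω ∂μ,
      (μ[fun ω' => Real.exp (l * η ω') | m]) ω ≤ Real.exp (l ^ 2 * σ ^ 2 / 2))
    (l : ℝ) {A : Set Ω} (hA : MeasurableSet[m] A) :
    ∫⁻ ω in A, ENNReal.ofReal (Real.exp (l * η ω)) ∂μ ≤
      ∫⁻ _ in A, ENNReal.ofReal (Real.exp (l ^ 2 * σ ^ 2 / 2)) ∂μ := by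
  rw [← ofReal_integral_eq_lintegral_ofReal (hint l).integrableOn
    (Eventually.of_forall fun _ => (Real.exp_pos _).le),
    ← ofReal_integral_eq_lintegral_ofReal (integrable_const _)
    (Eventually.of_forall fun _ => (Real.exp_pos _).le)]
  refine ENNReal.ofReal_le_ofReal ?_
  rw [← setIntegral_condExp hm (hint l) hA]
  exact setIntegral_mono_ae integrable_condExp.integrableOn (integrable_const _).integrableOn
    (hsub l)

/-- The multiplier takes countably many values, each on an `m`-measurable set where the bound for
constant multipliers applies. -/
theorem setLIntegral_exp_int_mul_le (hm : m ≤ m0)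
    (hint : ∀ l : ℝ, Integrable (fun ω => Real.exp (l * η ω)) μ)
    (hsub : ∀ l : ℝ, ∀ᵐ ω ∂μ,
      (μ[fun ω' => Real.exp (l * η ω') | m]) ω ≤ Real.exp (l ^ 2 * σ ^ 2 / 2))
    {k : Ω → ℤ} (hk : Measurable[m] k) (n : ℕ) {A : Set Ω} (hA : MeasurableSet[m] A) :
    ∫⁻ ω in A, ENNReal.ofReal (Real.exp ((k ω : ℝ) / n * η ω)) ∂μ ≤
      ∫⁻ ω in A, ENNReal.ofReal (Real.exp (((k ω : ℝ) / n) ^ 2 * σ ^ 2 / 2)) ∂μ := by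
  have hAk : A = ⋃ i : ℤ, A ∩ k ⁻¹' {i} := by ext; simp
  have hmeas : ∀ i : ℤ, MeasurableSet[m] (A ∩ k ⁻¹' {i}) := fun i =>
    hA.inter (hk (measurableSet_singleton i))
  have hdisj : Pairwise (Function.onFun Disjoint fun i : ℤ => A ∩ k ⁻¹' {i}) := by
    intro i j hij
    refine Set.disjoint_left.2 fun ω h1 h2 => hij ?_
    exact h1.2.symm.trans h2.2
  rw [hAk, lintegral_iUnion (fun i => hm _ (hmeas i)) hdisj,
    lintegral_iUnion (fun i => hm _ (hmeas i)) hdisj]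
  refine ENNReal.tsum_le_tsum fun i => ?_
  have hval : ∀ ω ∈ A ∩ k ⁻¹' {i}, k ω = i := fun ω h => h.2
  have c1 : ∫⁻ ω in A ∩ k ⁻¹' {i}, ENNReal.ofReal (Real.exp ((k ω : ℝ) / n * η ω)) ∂μ =
      ∫⁻ ω in A ∩ k ⁻¹' {i}, ENNReal.ofReal (Real.exp ((i : ℝ) / n * η ω)) ∂μ :=
    setLIntegral_congr_fun (hm _ (hmeas i)) fun ω h => by simp only [hval ω h]
  have c2 : ∫⁻ ω in A ∩ k ⁻¹' {i}, ENNReal.ofReal (Real.exp (((k ω : ℝ) / n) ^ 2 * σ ^ 2 / 2)) ∂μ =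
      ∫⁻ _ in A ∩ k ⁻¹' {i}, ENNReal.ofReal (Real.exp (((i : ℝ) / n) ^ 2 * σ ^ 2 / 2)) ∂μ :=
    setLIntegral_congr_fun (hm _ (hmeas i)) fun ω h => by simp only [hval ω h]
  rw [c1, c2]
  exact setLIntegral_exp_const_mul_le hm hint hsub _ (hmeas i)

/-- Discretize the multiplier and let the mesh tend to `0`, with Fatou on the left. Rounding towards
zero never increases `l ω ^ 2`, so the right side needs no limit. -/
theorem setLIntegral_exp_mul_le (hm : m ≤ m0) (hη : Measurable η)
    (hint : ∀ l : ℝ, Integrable (fun ω => Real.exp (l * η ω)) μ)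
    (hsub : ∀ l : ℝ, ∀ᵐ ω ∂μ,
      (μ[fun ω' => Real.exp (l * η ω') | m]) ω ≤ Real.exp (l ^ 2 * σ ^ 2 / 2))
    {l : Ω → ℝ} (hl : Measurable[m] l) {A : Set Ω} (hA : MeasurableSet[m] A) :
    ∫⁻ ω in A, ENNReal.ofReal (Real.exp (l ω * η ω)) ∂μ ≤
      ∫⁻ ω in A, ENNReal.ofReal (Real.exp (l ω ^ 2 * σ ^ 2 / 2)) ∂μ := by
  have hk : ∀ n, Measurable[m] fun ω => roundToZero n (l ω) := fun n =>
    (measurable_roundToZero n).comp hl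
  have hlim : ∀ ω, Tendsto (fun n : ℕ =>
      ENNReal.ofReal (Real.exp ((roundToZero n (l ω) : ℝ) / n * η ω))) atTop
      (𝓝 (ENNReal.ofReal (Real.exp (l ω * η ω)))) := fun ω =>
    ENNReal.tendsto_ofReal ((Real.continuous_exp.tendsto _).comp
      ((tendsto_roundToZero_div (l ω)).mul_const _))
  have hmeas : ∀ n : ℕ, Measurable[m0] fun ω =>
      ENNReal.ofReal (Real.exp ((roundToZero n (l ω) : ℝ) / n * η ω)) := fun n => by
    have h1 : Measurable[m0] fun ω => (roundToZero n (l ω) : ℝ) :=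
      (measurable_from_top (f := fun z : ℤ => (z : ℝ))).comp ((hk n).mono hm le_rfl)
    exact (Real.measurable_exp.comp ((h1.div_const _).mul hη)).ennreal_ofReal
  calc ∫⁻ ω in A, ENNReal.ofReal (Real.exp (l ω * η ω)) ∂μ
      = ∫⁻ ω in A, liminf (fun n : ℕ =>
          ENNReal.ofReal (Real.exp ((roundToZero n (l ω) : ℝ) / n * η ω))) atTop ∂μ := by
        simp only [(hlim _).liminf_eq]
    _ ≤ liminf (fun n : ℕ => ∫⁻ ω in A,
          ENNReal.ofReal (Real.exp ((roundToZero n (l ω) : ℝ) / n * η ω)) ∂μ) atTop :=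
        lintegral_liminf_le hmeas
    _ ≤ ∫⁻ ω in A, ENNReal.ofReal (Real.exp (l ω ^ 2 * σ ^ 2 / 2)) ∂μ := by
        refine liminf_le_of_le ⟨0, Eventually.of_forall fun _ => zero_le⟩ fun b hb => ?_
        obtain ⟨n, hn⟩ := hb.exists
        refine hn.trans ((setLIntegral_exp_int_mul_le hm hint hsub (hk n) n hA).trans
          (lintegral_mono fun ω => ENNReal.ofReal_le_ofReal (Real.exp_le_exp.2 ?_)))
        have := sq_le_sq.2 (abs_roundToZero_div_le n (l ω))
        gcongr

/-- The bound on all `m`-measurable sets is an inequality between two measures trimmed to `m`, and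
so extends to `m`-measurable weights. -/
theorem lintegral_mul_exp_mul_le (hm : m ≤ m0) (hη : Measurable η)
    (hint : ∀ l : ℝ, Integrable (fun ω => Real.exp (l * η ω)) μ)
    (hsub : ∀ l : ℝ, ∀ᵐ ω ∂μ,
      (μ[fun ω' => Real.exp (l * η ω') | m]) ω ≤ Real.exp (l ^ 2 * σ ^ 2 / 2))
    {l : Ω → ℝ} (hl : Measurable[m] l) {F : Ω → ℝ≥0∞} (hF : Measurable[m] F) :
    ∫⁻ ω, ENNReal.ofReal (Real.exp (l ω * η ω)) * F ω ∂μ ≤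
      ∫⁻ ω, ENNReal.ofReal (Real.exp (l ω ^ 2 * σ ^ 2 / 2)) * F ω ∂μ := by
  have hl0 : Measurable[m0] l := hl.mono hm le_rfl
  have hF0 : Measurable[m0] F := hF.mono hm le_rfl
  have h1 : Measurable fun ω => ENNReal.ofReal (Real.exp (l ω * η ω)) := by fun_prop
  have h2 : Measurable fun ω => ENNReal.ofReal (Real.exp (l ω ^ 2 * σ ^ 2 / 2)) := by fun_prop
  have hle : (μ.withDensity fun ω => ENNReal.ofReal (Real.exp (l ω * η ω))).trim hm ≤
      (μ.withDensity fun ω => ENNReal.ofReal (Real.exp (l ω ^ 2 * σ ^ 2 / 2))).trim hm := by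
    refine Measure.le_iff.2 fun A hA => ?_
    rw [trim_measurableSet_eq hm hA, trim_measurableSet_eq hm hA, withDensity_apply _ (hm _ hA),
      withDensity_apply _ (hm _ hA)]
    exact setLIntegral_exp_mul_le hm hη hint hsub hl hA
  have e1 := lintegral_withDensity_eq_lintegral_mul μ h1 hF0
  have e2 := lintegral_withDensity_eq_lintegral_mul μ h2 hF0
  simp only [Pi.mul_apply] at e1 e2
  rw [← e1, ← e2, ← lintegral_trim hm hF, ← lintegral_trim hm hF]
  exact lintegral_mono' hle le_rfl

/-- The nonnegative variable `e^η + e^{-η} - 2` has mean at most `0`, hence vanishes almost surely.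
This settles the noiseless case `σ = 0`, where the grid argument would divide by `σ`. -/
theorem ae_eq_zero_of_condExp_exp_le_one (hm : m ≤ m0)
    (hint : ∀ l : ℝ, Integrable (fun ω => Real.exp (l * η ω)) μ)
    (hsub : ∀ l : ℝ, ∀ᵐ ω ∂μ, (μ[fun ω' => Real.exp (l * η ω') | m]) ω ≤ 1) :
    ∀ᵐ ω ∂μ, η ω = 0 := by
  have h1 : ∀ l : ℝ, ∫ ω, Real.exp (l * η ω) ∂μ ≤ 1 := by
    intro l
    rw [← integral_condExp hm]
    simpa using integral_mono_ae integrable_condExp (integrable_const (1 : ℝ)) (hsub l)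
  have hi : Integrable (fun ω => Real.exp (1 * η ω) + Real.exp (-1 * η ω) - 2) μ :=
    ((hint 1).add (hint (-1))).sub (integrable_const _)
  have h0 : ∀ y : ℝ, 0 ≤ Real.exp (1 * y) + Real.exp (-1 * y) - 2 := fun y => by
    have := Real.one_le_cosh y
    rw [Real.cosh_eq] at this
    rw [one_mul, neg_one_mul]
    linarith
  have h2 : ∫ ω, (Real.exp (1 * η ω) + Real.exp (-1 * η ω) - 2) ∂μ = 0 := by
    refine le_antisymm ?_ (integral_nonneg fun ω => h0 _)
    have h3 : Integrable (fun ω => Real.exp (1 * η ω) + Real.exp (-1 * η ω)) μ :=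
      (hint 1).add (hint (-1))
    rw [integral_sub h3 (integrable_const _), integral_add (hint 1) (hint (-1))]
    simp only [integral_const, probReal_univ, smul_eq_mul]
    linarith [h1 1, h1 (-1)]
  have h3 := (integral_eq_zero_iff_of_nonneg (fun ω => h0 (η ω)) hi).1 h2
  filter_upwards [h3] with ω hω
  by_contra hne
  have := Real.one_lt_cosh.2 hne
  rw [Real.cosh_eq] at this
  simp only [one_mul, neg_one_mul, Pi.zero_apply] at hω
  linarith

variable {d : ℕ}

/-- The exponent of the self-normalized exponential process in direction `v`. -/
noncomputable def selfNormExponent (σ : ℝ) (x : ℕ → Vec d) (e : ℕ → ℝ) (v : Vec d) (t : ℕ) : ℝ :=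
  ∑ s ∈ Finset.Icc 1 t, (e s * inner ℝ (x s) v - σ ^ 2 / 2 * inner ℝ (x s) v ^ 2)

theorem measurable_selfNormExponent {m : MeasurableSpace Ω} {x : ℕ → Ω → Vec d} {e : ℕ → Ω → ℝ}
    {t : ℕ} (hx : ∀ s ∈ Finset.Icc 1 t, Measurable (x s))
    (he : ∀ s ∈ Finset.Icc 1 t, Measurable (e s)) (σ : ℝ) (v : Vec d) :
    Measurable fun ω => selfNormExponent σ (fun s => x s ω) (fun s => e s ω) v t := by
  refine Finset.measurable_sum _ fun s hs => ?_
  have h1 := hx s hs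
  have h2 := he s hs
  fun_prop

/-- The process is a supermartingale: given the pre-reward information, the last noise contributes
at most the factor that the quadratic term cancels. Working with `∫⁻` avoids any integrability
question for the product. -/
theorem lintegral_exp_selfNormExponent_le {𝒢 : ℕ → MeasurableSpace Ω} {x : ℕ → Ω → Vec d}
    {e : ℕ → Ω → ℝ} {T : ℕ} (hle : ∀ s ∈ Finset.Icc 1 T, 𝒢 s ≤ m0)
    (hx : ∀ s ∈ Finset.Icc 1 T, ∀ r ∈ Finset.Icc 1 s, Measurable[𝒢 s] (x r))
    (he : ∀ s ∈ Finset.Icc 1 T, ∀ r ∈ Finset.Icc 1 (s - 1), Measurable[𝒢 s] (e r))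
    (he0 : ∀ s ∈ Finset.Icc 1 T, Measurable (e s))
    (hint : ∀ s ∈ Finset.Icc 1 T, ∀ l : ℝ, Integrable (fun ω => Real.exp (l * e s ω)) μ)
    (hsub : ∀ s ∈ Finset.Icc 1 T, ∀ l : ℝ, ∀ᵐ ω ∂μ,
      (μ[fun ω' => Real.exp (l * e s ω') | 𝒢 s]) ω ≤ Real.exp (l ^ 2 * σ ^ 2 / 2))
    (v : Vec d) (t : ℕ) (ht : t ≤ T) :
    ∫⁻ ω, ENNReal.ofReal
      (Real.exp (selfNormExponent σ (fun s => x s ω) (fun s => e s ω) v t)) ∂μ ≤ 1 := by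
  induction t with
  | zero => simp [selfNormExponent]
  | succ t ih =>
    have hmem : t + 1 ∈ Finset.Icc 1 T := Finset.mem_Icc.2 ⟨by omega, ht⟩
    have hl : Measurable[𝒢 (t + 1)] fun ω => inner ℝ (x (t + 1) ω) v := by
      have := hx _ hmem (t + 1) (Finset.mem_Icc.2 ⟨by omega, le_rfl⟩)
      fun_prop
    have hU : Measurable[𝒢 (t + 1)] fun ω =>
        selfNormExponent σ (fun s => x s ω) (fun s => e s ω) v t :=
      measurable_selfNormExponent
        (fun s hs => hx _ hmem s (Finset.Icc_subset_Icc_right (Nat.le_succ t) hs))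
        (fun s hs => he _ hmem s hs) σ v
    have hF : Measurable[𝒢 (t + 1)] fun ω => ENNReal.ofReal (Real.exp
        (selfNormExponent σ (fun s => x s ω) (fun s => e s ω) v t -
          σ ^ 2 / 2 * inner ℝ (x (t + 1) ω) v ^ 2)) := by
      fun_prop
    have h := lintegral_mul_exp_mul_le (hle _ hmem) (he0 _ hmem) (hint _ hmem) (hsub _ hmem) hl hF
    have e1 : ∀ ω, ENNReal.ofReal (Real.exp
        (selfNormExponent σ (fun s => x s ω) (fun s => e s ω) v (t + 1))) =
        ENNReal.ofReal (Real.exp (inner ℝ (x (t + 1) ω) v * e (t + 1) ω)) *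
        ENNReal.ofReal (Real.exp (selfNormExponent σ (fun s => x s ω) (fun s => e s ω) v t -
          σ ^ 2 / 2 * inner ℝ (x (t + 1) ω) v ^ 2)) := by
      intro ω
      rw [← ENNReal.ofReal_mul (Real.exp_pos _).le, ← Real.exp_add]
      congr 2
      unfold selfNormExponent
      rw [Finset.sum_Icc_succ_top (by omega)]
      ring
    have e2 : ∀ ω, ENNReal.ofReal (Real.exp (inner ℝ (x (t + 1) ω) v ^ 2 * σ ^ 2 / 2)) *
        ENNReal.ofReal (Real.exp (selfNormExponent σ (fun s => x s ω) (fun s => e s ω) v t -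
          σ ^ 2 / 2 * inner ℝ (x (t + 1) ω) v ^ 2)) =
        ENNReal.ofReal (Real.exp (selfNormExponent σ (fun s => x s ω) (fun s => e s ω) v t)) := by
      intro ω
      rw [← ENNReal.ofReal_mul (Real.exp_pos _).le, ← Real.exp_add]
      congr 2
      ring
    simp only [e1]
    refine h.trans ?_
    simp only [e2]
    exact ih (by omega)

end Noise

theorem measureReal_exists_le_selfNormExponent_le {Ω : Type*} {m0 : MeasurableSpace Ω}
    {μ : Measure Ω} {d : ℕ} {σ : ℝ} {x : ℕ → Ω → Vec d} {e : ℕ → Ω → ℝ} {t : ℕ}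
    (hx : ∀ s ∈ Finset.Icc 1 t, Measurable (x s)) (he : ∀ s ∈ Finset.Icc 1 t, Measurable (e s))
    (hU : ∀ v : Vec d, ∫⁻ ω, ENNReal.ofReal
      (Real.exp (selfNormExponent σ (fun s => x s ω) (fun s => e s ω) v t)) ∂μ ≤ 1)
    {ι : Type*} (N : Finset ι) (f : ι → Vec d) (K : ℝ) :
    μ.real {ω | ∃ k ∈ N, K ≤ selfNormExponent σ (fun s => x s ω) (fun s => e s ω) (f k) t} ≤
      N.card * Real.exp (-K) := by
  have hset : {ω | ∃ k ∈ N, K ≤ selfNormExponent σ (fun s => x s ω) (fun s => e s ω) (f k) t} =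
      ⋃ k ∈ N, {ω | K ≤ selfNormExponent σ (fun s => x s ω) (fun s => e s ω) (f k) t} := by
    ext; simp
  rw [hset, ← nsmul_eq_mul, ← Finset.sum_const]
  refine (measureReal_biUnion_finset_le _ _).trans (Finset.sum_le_sum fun k _ => ?_)
  have hm := (measurable_selfNormExponent hx he σ (f k))
  have hmeas : Measurable fun ω => ENNReal.ofReal
      (Real.exp (selfNormExponent σ (fun s => x s ω) (fun s => e s ω) (f k) t)) := by fun_prop
  have h1 := (mul_meas_ge_le_lintegral (μ := μ) hmeas (ENNReal.ofReal (Real.exp K))).trans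
    (hU (f k))
  have h2 : {ω | ENNReal.ofReal (Real.exp K) ≤ ENNReal.ofReal
      (Real.exp (selfNormExponent σ (fun s => x s ω) (fun s => e s ω) (f k) t))} =
      {ω | K ≤ selfNormExponent σ (fun s => x s ω) (fun s => e s ω) (f k) t} := by
    ext ω
    simp [ENNReal.ofReal_le_ofReal_iff (Real.exp_pos _).le]
  rw [h2] at h1
  have h3 := ENNReal.toReal_mono ENNReal.one_ne_top h1
  rw [ENNReal.toReal_mul, ENNReal.toReal_ofReal (Real.exp_pos _).le, ENNReal.toReal_one] at h3
  rw [Real.exp_neg, ← one_div, le_div_iff₀' (Real.exp_pos K)]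
  exact h3

/-! ### A grid argument for the estimation error -/

/-- The point of the grid `h ℤ^d` with integer coordinates `k`. -/
noncomputable def gridPoint {d : ℕ} (h : ℝ) (k : Fin d → ℤ) : Vec d :=
  WithLp.toLp 2 fun j => h * k j

theorem exists_gridPoint_near {d : ℕ} {h R : ℝ} (hh : 0 < h) {M : ℕ} (hM : R / h + 1 ≤ M)
    {v : Vec d} (hv : ‖v‖ ≤ R) :
    ∃ k ∈ Fintype.piFinset fun _ : Fin d => Finset.Icc (-(M : ℤ)) M,
      ‖gridPoint h k - v‖ ^ 2 ≤ d * h ^ 2 := by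
  refine ⟨fun j => round (v j / h), ?_, ?_⟩
  · rw [Fintype.mem_piFinset]
    intro j
    have h1 : |v j / h| ≤ R / h := by
      rw [abs_div, abs_of_pos hh]
      have : |v j| ≤ ‖v‖ := PiLp.norm_apply_le v j
      gcongr
      linarith
    have h2 := abs_sub_round (v j / h)
    rw [abs_le] at h1 h2
    rw [Finset.mem_Icc]
    constructor
    · have : (-(M : ℝ)) ≤ round (v j / h) := by linarith
      exact_mod_cast this
    · have : (round (v j / h) : ℝ) ≤ M := by linarith
      exact_mod_cast this
  · rw [EuclideanSpace.real_norm_sq_eq]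
    have h1 : ∀ j ∈ (Finset.univ : Finset (Fin d)),
        ((gridPoint h (fun j => round (v j / h)) - v : Vec d) j) ^ 2 ≤ h ^ 2 := by
      intro j _
      have e : (gridPoint h (fun j => round (v j / h)) - v : Vec d) j =
          -h * (v j / h - round (v j / h)) := by
        simp only [gridPoint, PiLp.sub_apply]
        field_simp
        ring
      rw [e, mul_pow, neg_sq]
      have h2 := abs_sub_round (v j / h)
      have h3 : (v j / h - round (v j / h)) ^ 2 ≤ 1 := by
        rw [sq_le_one_iff_abs_le_one]; linarith
      exact mul_le_of_le_one_right (by positivity) h3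
    refine (Finset.sum_le_sum h1).trans ?_
    simp

/-- The main term is at least `a y² / 2 ≥ G y / 2` and the cross term at least `-y`. With `G ≥ 4`
and `y ≥ G` this leaves `G² / 4`, which also covers the remaining `1/2`. -/
theorem sq_div_eight_le {a y p G c : ℝ} (ha0 : 0 ≤ a) (ha1 : a ≤ 1) (hG : 4 ≤ G) (hp : |p| ≤ y)
    (hay : G ≤ a * y) (hc : c ≤ 1 / 2) :
    G ^ 2 / 8 ≤ (a - a ^ 2 / 2) * y ^ 2 + (1 - a) * p - c := by
  have hy0 : 0 ≤ y := (abs_nonneg p).trans hp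
  have hyG : G ≤ y := hay.trans (mul_le_of_le_one_left hy0 ha1)
  have h1 : -y ≤ (1 - a) * p := by
    have := (abs_le.1 hp).1
    nlinarith
  have h2 : G * y / 2 ≤ (a - a ^ 2 / 2) * y ^ 2 := by
    have h3 : a / 2 ≤ a - a ^ 2 / 2 := by nlinarith
    calc G * y / 2 ≤ (a * y) * y / 2 := by gcongr
      _ = a / 2 * y ^ 2 := by ring
      _ ≤ _ := by gcongr
  nlinarith

/-- Without rounding, the exponent at `(a / σ²) E` is `(a - a² / 2) Q / σ²` by the normal equations
`hE`. The factor `a = r / ‖E‖` keeps this point in the ball of radius `r / σ²`, however large `E`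
is, so a finite grid suffices. -/
theorem exists_le_selfNormExponent_of_norm_gt {d t : ℕ} {x : ℕ → Vec d} {e : ℕ → ℝ} {E : Vec d}
    (hE : ∀ v : Vec d, ∑ s ∈ Finset.Icc 1 t, inner ℝ (x s) E * inner ℝ (x s) v =
      ∑ s ∈ Finset.Icc 1 t, e s * inner ℝ (x s) v)
    {κ L σ r G h : ℝ} {M : ℕ} (hσ : 0 < σ)
    (hlow : ∀ u : Vec d, κ * ‖u‖ ^ 2 ≤ ∑ s ∈ Finset.Icc 1 t, inner ℝ (x s) u ^ 2)
    (hup : ∀ s ∈ Finset.Icc 1 t, ‖x s‖ ≤ L) (hr0 : 0 < r) (hr : r < ‖E‖) (hG : 4 ≤ G)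
    (hrG : σ ^ 2 * G ^ 2 ≤ r ^ 2 * κ) (hh : 0 < h) (hh2 : h ^ 2 * d * L ^ 2 * t * σ ^ 2 ≤ 1)
    (hM : r / σ ^ 2 / h + 1 ≤ M) :
    ∃ k ∈ Fintype.piFinset fun _ : Fin d => Finset.Icc (-(M : ℤ)) M,
      G ^ 2 / 8 ≤ selfNormExponent σ x e (gridPoint h k) t := by
  have hE0 : 0 < ‖E‖ := hr0.trans hr
  set a : ℝ := r / ‖E‖ with ha
  have ha0 : 0 < a := by positivity
  have ha1 : a ≤ 1 := (div_le_one hE0).2 hr.le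
  have hv : ‖(a / σ ^ 2) • E‖ ≤ r / σ ^ 2 := by
    rw [norm_smul, Real.norm_of_nonneg (by positivity), ha]
    refine le_of_eq ?_
    field_simp
  obtain ⟨k, hk, hkw⟩ := exists_gridPoint_near hh hM hv
  refine ⟨k, hk, ?_⟩
  set w : Vec d := gridPoint h k - (a / σ ^ 2) • E with hw
  have hgw : gridPoint h k = (a / σ ^ 2) • E + w := by rw [hw]; abel
  set Q := ∑ s ∈ Finset.Icc 1 t, inner ℝ (x s) E ^ 2 with hQ
  set q := ∑ s ∈ Finset.Icc 1 t, inner ℝ (x s) w ^ 2 with hq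
  set p := ∑ s ∈ Finset.Icc 1 t, inner ℝ (x s) E * inner ℝ (x s) w with hp
  have hU : selfNormExponent σ x e (gridPoint h k) t =
      (a - a ^ 2 / 2) * (Q / σ ^ 2) + (1 - a) * p - σ ^ 2 / 2 * q := by
    unfold selfNormExponent
    rw [Finset.sum_sub_distrib, ← hE, hgw, hQ, hq, hp, Finset.sum_div, Finset.mul_sum,
      Finset.mul_sum, Finset.mul_sum, ← Finset.sum_add_distrib, ← Finset.sum_sub_distrib,
      ← Finset.sum_sub_distrib]
    refine Finset.sum_congr rfl fun s _ => ?_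
    -- The noise enters only through `hE`, which turns the linear term into an inner product with
    -- `E`.
    rw [inner_add_right, real_inner_smul_right]
    field_simp
    ring
  -- The mesh condition `hh2` is what makes the rounding error `w` negligible in the Gram seminorm;
  -- the norm bound on the contexts enters here.
  have hqb : q * σ ^ 2 ≤ 1 := by
    have h1 : q ≤ ∑ s ∈ Finset.Icc 1 t, L ^ 2 * (d * h ^ 2) := by
      refine Finset.sum_le_sum fun s hs => ?_
      have h2 := abs_real_inner_le_norm (x s) w
      rw [← sq_abs]
      calc |inner ℝ (x s) w| ^ 2 ≤ (‖x s‖ * ‖w‖) ^ 2 := by gcongr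
        _ = ‖x s‖ ^ 2 * ‖w‖ ^ 2 := mul_pow _ _ _
        _ ≤ L ^ 2 * (d * h ^ 2) := by
            have := hup s hs
            gcongr
    rw [Finset.sum_const, Nat.card_Icc, nsmul_eq_mul, Nat.add_sub_cancel] at h1
    calc q * σ ^ 2 ≤ (t * (L ^ 2 * (d * h ^ 2))) * σ ^ 2 := by gcongr
      _ = h ^ 2 * d * L ^ 2 * t * σ ^ 2 := by ring
      _ ≤ 1 := hh2
  have hQ0 : 0 ≤ Q := Finset.sum_nonneg fun _ _ => sq_nonneg _
  have hpQ : p ^ 2 ≤ Q * q := Finset.sum_mul_sq_le_sq_mul_sq _ _ _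
  set y : ℝ := √Q / σ with hy
  have hy0 : 0 ≤ y := by positivity
  have hy2 : Q / σ ^ 2 = y ^ 2 := by rw [hy, div_pow, Real.sq_sqrt hQ0]
  have hQy : Q = σ ^ 2 * y ^ 2 := by rw [← hy2]; field_simp
  have hpy : |p| ≤ y := by
    refine abs_le_of_sq_le_sq (hpQ.trans ?_) hy0
    rw [hQy]
    nlinarith [sq_nonneg y]
  have hay : G ≤ a * y := by
    refine (pow_le_pow_iff_left₀ (by linarith) (by positivity) two_ne_zero).1 ?_
    have h1 : r ^ 2 * κ ≤ a ^ 2 * Q := by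
      have := hlow E
      rw [ha, div_pow, div_mul_eq_mul_div, le_div_iff₀ (by positivity)]
      nlinarith [sq_nonneg r]
    rw [hQy] at h1
    have h2 : σ ^ 2 * G ^ 2 ≤ σ ^ 2 * (a * y) ^ 2 := by
      refine (hrG.trans h1).trans (le_of_eq ?_); ring
    exact le_of_mul_le_mul_left h2 (by positivity)
  rw [hU, hy2]
  exact sq_div_eight_le ha0.le ha1 hG hpy hay (by linarith)

/-! ### Tails of sub-exponential random vectors -/

section Tails

variable {Ω : Type*} [MeasurableSpace Ω] {μ : Measure Ω} {d : ℕ}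

theorem lintegral_enorm_pow_le_of_psiOneNorm_le {Z : Ω → ℝ} {b : ℝ}
    (hZ : psiOneNorm μ Z ≤ ENNReal.ofReal b) {n : ℕ} (hn : 1 ≤ n) :
    ∫⁻ ω, ‖Z ω‖ₑ ^ n ∂μ ≤ ENNReal.ofReal (n * b) ^ n := by
  have hn0 : (0 : ℝ) < n := by exact_mod_cast hn
  have h1 : eLpNorm Z (ENNReal.ofReal n) μ / ENNReal.ofReal n ≤ ENNReal.ofReal b :=
    (le_iSup₂ (f := fun (p : ℝ) (_ : 1 ≤ p) =>
      eLpNorm Z (ENNReal.ofReal p) μ / ENNReal.ofReal p) (n : ℝ) (by exact_mod_cast hn)).trans hZ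
  have hpos : ENNReal.ofReal n ≠ 0 := (ENNReal.ofReal_pos.2 hn0).ne'
  rw [ENNReal.div_le_iff hpos ENNReal.ofReal_ne_top, mul_comm, ← ENNReal.ofReal_mul hn0.le,
    eLpNorm_eq_lintegral_rpow_enorm_toReal hpos ENNReal.ofReal_ne_top,
    ENNReal.toReal_ofReal hn0.le, one_div, ENNReal.rpow_inv_le_iff hn0] at h1
  simpa only [ENNReal.rpow_natCast] using h1

theorem psiOneNorm_apply_le {X : Ω → Vec d} {b : ℝ≥0∞} (hX : psiOneNormVec μ X ≤ b) (j : Fin d) :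
    psiOneNorm μ (fun ω => X ω j) ≤ b := by
  have h := (le_iSup₂ (f := fun (u : Vec d) (_ : ‖u‖ = 1) =>
    psiOneNorm μ (fun ω => inner ℝ u (X ω))) (EuclideanSpace.single j (1 : ℝ)) (by simp)).trans hX
  simpa [EuclideanSpace.inner_single_left] using h

/-- The power-mean inequality reduces `‖X‖^(2m) = (∑ X_j²)^m` to the coordinates, whose `2m`-th
moments are read off from the `ψ₁` norm at `p = 2m`. -/
theorem integrable_norm_pow_and_integral_le {X : Ω → Vec d} (hXm : Measurable X) {b : ℝ}
    (hb : 0 ≤ b) (hX : psiOneNormVec μ X ≤ ENNReal.ofReal b) {m : ℕ} (hm : 1 ≤ m) :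
    Integrable (fun ω => ‖X ω‖ ^ (2 * m)) μ ∧
      ∫ ω, ‖X ω‖ ^ (2 * m) ∂μ ≤ (d * (2 * m * b) ^ 2) ^ m := by
  have hj : ∀ j, Measurable fun ω => X ω j := fun j => by fun_prop
  have hcoord : ∀ j, Integrable (fun ω => (X ω j ^ 2) ^ m) μ ∧
      ∫ ω, (X ω j ^ 2) ^ m ∂μ ≤ (2 * m * b) ^ (2 * m) := by
    intro j
    have h := lintegral_enorm_pow_le_of_psiOneNorm_le (psiOneNorm_apply_le hX j)
      (n := 2 * m) (by omega)
    have e : ∀ ω, ‖X ω j‖ₑ ^ (2 * m) = ENNReal.ofReal ((X ω j ^ 2) ^ m) := by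
      intro ω
      rw [← ofReal_norm, ← ENNReal.ofReal_pow (norm_nonneg _), Real.norm_eq_abs, pow_mul,
        sq_abs]
    simp only [e] at h
    have h0 : ∀ ω, 0 ≤ (X ω j ^ 2) ^ m := fun ω => by positivity
    have hint : Integrable (fun ω => (X ω j ^ 2) ^ m) μ := by
      refine ⟨(by have := hj j; fun_prop), ?_⟩
      rw [hasFiniteIntegral_iff_ofReal (Filter.Eventually.of_forall h0)]
      exact h.trans_lt (ENNReal.pow_lt_top ENNReal.ofReal_lt_top)
    refine ⟨hint, ?_⟩
    rw [← ofReal_integral_eq_lintegral_ofReal hint (Filter.Eventually.of_forall h0),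
      ← ENNReal.ofReal_pow (by positivity), ENNReal.ofReal_le_ofReal_iff (by positivity)] at h
    push_cast at h
    exact h
  have hpt : ∀ ω, ‖X ω‖ ^ (2 * m) ≤ (d : ℝ) ^ (m - 1) * ∑ j, (X ω j ^ 2) ^ m := by
    intro ω
    obtain ⟨k, rfl⟩ : ∃ k, m = k + 1 := ⟨m - 1, by omega⟩
    rw [pow_mul, EuclideanSpace.real_norm_sq_eq]
    simpa using pow_sum_le_card_mul_sum_pow (s := Finset.univ) (f := fun j => X ω j ^ 2)
      (fun j _ => sq_nonneg _) k
  have hsum : Integrable (fun ω => (d : ℝ) ^ (m - 1) * ∑ j, (X ω j ^ 2) ^ m) μ :=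
    (integrable_finsetSum _ fun j _ => (hcoord j).1).const_mul _
  have hint : Integrable (fun ω => ‖X ω‖ ^ (2 * m)) μ :=
    hsum.mono' (by fun_prop) (Filter.Eventually.of_forall fun ω => by
      rw [Real.norm_of_nonneg (by positivity)]; exact hpt ω)
  refine ⟨hint, (integral_mono hint hsum hpt).trans ?_⟩
  rw [integral_const_mul, integral_finsetSum _ fun j _ => (hcoord j).1]
  have h1 : ∑ j : Fin d, ∫ ω, (X ω j ^ 2) ^ m ∂μ ≤ ∑ _j : Fin d, (2 * m * b) ^ (2 * m) :=
    Finset.sum_le_sum fun j _ => (hcoord j).2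
  rw [Finset.sum_const, Finset.card_univ, Fintype.card_fin, nsmul_eq_mul] at h1
  calc _ ≤ (d : ℝ) ^ (m - 1) * (d * (2 * m * b) ^ (2 * m)) := by gcongr
    _ = (d : ℝ) ^ (m - 1 + 1) * (2 * m * b) ^ (2 * m) := by ring
    _ = _ := by rw [Nat.sub_add_cancel hm, mul_pow (d : ℝ), ← pow_mul]

theorem integral_norm_div_pow_le {X : Ω → Vec d} (hXm : Measurable X) {b L : ℝ} (hb : 0 ≤ b)
    (hL : 0 < L) (hX : psiOneNormVec μ X ≤ ENNReal.ofReal b) {m : ℕ} (hm : 1 ≤ m) {q : ℝ}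
    (hq : d * (2 * m * b) ^ 2 ≤ q * L ^ 2) :
    Integrable (fun ω => (‖X ω‖ / L) ^ (2 * m)) μ ∧ ∫ ω, (‖X ω‖ / L) ^ (2 * m) ∂μ ≤ q ^ m := by
  obtain ⟨h1, h2⟩ := integrable_norm_pow_and_integral_le hXm hb hX hm
  simp only [div_pow]
  refine ⟨h1.div_const _, ?_⟩
  rw [integral_div, div_le_iff₀ (by positivity), pow_mul L, ← mul_pow]
  exact h2.trans (by gcongr)

theorem integral_sqNormTail_le {X : Ω → Vec d} (hXm : Measurable X) {b L : ℝ} (hb : 0 ≤ b)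
    (hL : 0 < L) (hX : psiOneNormVec μ X ≤ ENNReal.ofReal b) {m : ℕ} (hm : 1 ≤ m) {q : ℝ}
    (hq : d * (2 * m * b) ^ 2 ≤ q * L ^ 2) :
    ∫ ω, sqNormTail L (X ω) ∂μ ≤ L ^ 2 * q ^ m := by
  obtain ⟨h1, h2⟩ := integral_norm_div_pow_le hXm hb hL hX hm hq
  refine (integral_mono_of_nonneg (Filter.Eventually.of_forall fun ω => sqNormTail_nonneg _ _)
    (h1.const_mul (L ^ 2)) (Filter.Eventually.of_forall fun ω => ?_)).trans ?_
  · simp only [sqNormTail]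
    split_ifs with h
    · positivity
    -- Outside the ball the ratio exceeds `1`, so raising its power from `2` to `2 * m` only
    -- increases it.
    · have h3 : 1 ≤ ‖X ω‖ / L := (one_le_div hL).2 (not_le.1 h).le
      calc ‖X ω‖ ^ 2 = L ^ 2 * (‖X ω‖ / L) ^ 2 := by field_simp
        _ ≤ L ^ 2 * (‖X ω‖ / L) ^ (2 * m) := by gcongr; omega
  · rw [integral_const_mul]; gcongr

theorem measureReal_lt_norm_le [IsFiniteMeasure μ] {X : Ω → Vec d} (hXm : Measurable X) {b L : ℝ} (hb : 0 ≤ b)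
    (hL : 0 < L) (hX : psiOneNormVec μ X ≤ ENNReal.ofReal b) {m : ℕ} (hm : 1 ≤ m) {q : ℝ}
    (hq : d * (2 * m * b) ^ 2 ≤ q * L ^ 2) :
    μ.real {ω | L < ‖X ω‖} ≤ q ^ m := by
  obtain ⟨h1, h2⟩ := integral_norm_div_pow_le hXm hb hL hX hm hq
  have h3 := mul_meas_ge_le_integral_of_nonneg
    (Filter.Eventually.of_forall fun ω => by positivity) h1 1
  rw [one_mul] at h3
  refine (measureReal_mono fun ω (hω : L < ‖X ω‖) => ?_).trans (h3.trans h2)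
  exact one_le_pow₀ ((one_le_div hL).2 hω.le)

end Tails

/-! ### From the individual arms to the chosen arm, at the cost of a factor `K`. -/

section Chosen

theorem comp_chosen_le_sum {Ω β : Type*} {K : ℕ} {a : ℕ → Ω → Fin K} {Z : ℕ → Fin K → Ω → β} {t : ℕ}
    {f : β → ℝ} (hf : ∀ v, 0 ≤ f v) (ω : Ω) : f (chosen a Z t ω) ≤ ∑ i, f (Z t i ω) :=
  Finset.single_le_sum (f := fun i => f (Z t i ω)) (fun _ _ => hf _) (Finset.mem_univ (a t ω))

variable {Ω : Type*} [MeasurableSpace Ω] {μ : Measure Ω} {d K : ℕ}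

theorem measurable_chosen {β : Type*} [MeasurableSpace β] {a : ℕ → Ω → Fin K}
    {Z : ℕ → Fin K → Ω → β} {t : ℕ} (ha : Measurable (a t)) (hZ : ∀ i, Measurable (Z t i)) :
    Measurable (chosen a Z t) := by
  have h : Measurable fun p : Fin K × Ω => Z t p.1 p.2 := measurable_from_prod_countable_right hZ
  exact h.comp (ha.prodMk measurable_id)

variable {a : ℕ → Ω → Fin K} {X : ℕ → Fin K → Ω → Vec d} {t : ℕ}

theorem integrable_sq_norm_chosen (ha : Measurable (a t)) (hXm : ∀ i, Measurable (X t i)) {b : ℝ}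
    (hb : 0 ≤ b) (hX : ∀ i, psiOneNormVec μ (X t i) ≤ ENNReal.ofReal b) :
    Integrable (fun ω => ‖chosen a X t ω‖ ^ 2) μ := by
  have h := fun i => (integrable_norm_pow_and_integral_le (hXm i) hb (hX i) le_rfl).1
  refine (integrable_finsetSum Finset.univ fun i _ => h i).mono'
    ((measurable_chosen ha hXm).norm.pow_const 2).aestronglyMeasurable
    (Filter.Eventually.of_forall fun ω => ?_)
  rw [Real.norm_of_nonneg (by positivity)]
  exact comp_chosen_le_sum (f := fun v : Vec d => ‖v‖ ^ 2) (fun v => by positivity) ω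

theorem integral_sqNormTail_chosen_le (hXm : ∀ i, Measurable (X t i)) {b L : ℝ} (hb : 0 ≤ b)
    (hL : 0 < L) (hX : ∀ i, psiOneNormVec μ (X t i) ≤ ENNReal.ofReal b) {m : ℕ} (hm : 1 ≤ m)
    {q : ℝ} (hq : d * (2 * m * b) ^ 2 ≤ q * L ^ 2) :
    ∫ ω, sqNormTail L (chosen a X t ω) ∂μ ≤ K * (L ^ 2 * q ^ m) := by
  have hint : ∀ i, Integrable (fun ω => sqNormTail L (X t i ω)) μ := fun i =>
    (integrable_norm_pow_and_integral_le (hXm i) hb (hX i) le_rfl).1.mono'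
      ((measurable_sqNormTail L).comp (hXm i)).aestronglyMeasurable
      (Filter.Eventually.of_forall fun ω => by
        rw [Real.norm_of_nonneg (sqNormTail_nonneg _ _)]; exact sqNormTail_le _ _)
  refine (integral_mono_of_nonneg (Filter.Eventually.of_forall fun ω => sqNormTail_nonneg _ _)
    (integrable_finsetSum Finset.univ fun i _ => hint i)
    (Filter.Eventually.of_forall fun ω => comp_chosen_le_sum (sqNormTail_nonneg L) ω)).trans ?_
  rw [integral_finsetSum _ fun i _ => hint i]
  refine (Finset.sum_le_sum fun i _ => integral_sqNormTail_le (hXm i) hb hL (hX i) hm hq).trans ?_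
  simp

theorem measureReal_lt_norm_chosen_le [IsFiniteMeasure μ] (hXm : ∀ i, Measurable (X t i)) {b L : ℝ}
    (hb : 0 ≤ b)
    (hL : 0 < L) (hX : ∀ i, psiOneNormVec μ (X t i) ≤ ENNReal.ofReal b) {m : ℕ} (hm : 1 ≤ m)
    {q : ℝ} (hq : d * (2 * m * b) ^ 2 ≤ q * L ^ 2) :
    μ.real {ω | L < ‖chosen a X t ω‖} ≤ K * q ^ m := by
  have hsub : {ω | L < ‖chosen a X t ω‖} ⊆ ⋃ i ∈ Finset.univ, {ω | L < ‖X t i ω‖} := fun ω hω =>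
    Set.mem_biUnion (Finset.mem_univ (a t ω)) hω
  refine (measureReal_mono hsub (measure_ne_top _ _)).trans
    ((measureReal_biUnion_finset_le _ _).trans ?_)
  refine (Finset.sum_le_sum fun i _ => measureReal_lt_norm_le (hXm i) hb hL (hX i) hm hq).trans ?_
  simp

end Chosen

/-! ### The histories of a bandit run -/

section History

variable {Ω : Type*} {d K : ℕ} {a : ℕ → Ω → Fin K} {X : ℕ → Fin K → Ω → Vec d}
  {Y : ℕ → Fin K → Ω → ℝ}

theorem chosen_reward_eq (a : ℕ → Ω → Fin K) (X : ℕ → Fin K → Ω → Vec d) (θs : Vec d)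
    (η : ℕ → Fin K → Ω → ℝ) (s : ℕ) (ω : Ω) :
    chosen a (reward θs X η) s ω = inner ℝ (chosen a X s ω) θs + chosen a η s ω := rfl

theorem history_mono : Monotone (history a X Y) := fun _ _ h =>
  biSup_mono fun _ hs => Finset.Icc_subset_Icc_right h hs

theorem measurable_chosen_context_history {r s : ℕ} (hr : r ∈ Finset.Icc 1 s) :
    Measurable[history a X Y s] (chosen a X r) := by
  refine Measurable.mono (comap_measurable (chosen a X r)) ?_ le_rfl
  exact le_trans (le_trans le_sup_right le_sup_left) (le_iSup₂_of_le r hr le_rfl)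

theorem measurable_chosen_reward_history {r s : ℕ} (hr : r ∈ Finset.Icc 1 s) :
    Measurable[history a X Y s] (chosen a Y r) := by
  refine Measurable.mono (comap_measurable (chosen a Y r)) ?_ le_rfl
  exact le_trans le_sup_right (le_iSup₂_of_le r hr le_rfl)

theorem measurable_chosen_context_preReward {r s : ℕ} (hr : r ∈ Finset.Icc 1 s) :
    Measurable[preReward a X Y s] (chosen a X r) := by
  have hr' := Finset.mem_Icc.1 hr
  rcases hr'.2.lt_or_eq with h | rfl
  · exact (measurable_chosen_context_history (Finset.mem_Icc.2 ⟨hr'.1, by omega⟩)).mono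
      le_sup_left le_rfl
  · exact (comap_measurable (chosen a X r)).mono (le_trans le_sup_right le_sup_right) le_rfl

theorem measurable_chosen_noise_preReward {θs : Vec d} {η : ℕ → Fin K → Ω → ℝ} {r s : ℕ}
    (hr : r ∈ Finset.Icc 1 (s - 1)) :
    Measurable[preReward a X (reward θs X η) s] (chosen a η r) := by
  have h1 : Measurable[preReward a X (reward θs X η) s] (chosen a (reward θs X η) r) :=
    (measurable_chosen_reward_history hr).mono le_sup_left le_rfl
  have h2 : Measurable[preReward a X (reward θs X η) s] (chosen a X r) :=
    (measurable_chosen_context_history hr).mono le_sup_left le_rfl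
  -- Past noises are observable given the parameter: they are the rewards minus their linear part.
  have e : chosen a η r = fun ω => chosen a (reward θs X η) r ω - inner ℝ (chosen a X r ω) θs := by
    ext ω
    rw [chosen_reward_eq, add_sub_cancel_left]
  rw [e]
  fun_prop

theorem history_le [m0 : MeasurableSpace Ω] {T : ℕ} (ha : ∀ s ∈ Finset.Icc 1 T, Measurable (a s))
    (hX : ∀ s ∈ Finset.Icc 1 T, Measurable (chosen a X s))
    (hY : ∀ s ∈ Finset.Icc 1 T, Measurable (chosen a Y s)) {s : ℕ} (hs : s ≤ T) :
    history a X Y s ≤ m0 := by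
  refine iSup₂_le fun r hr => ?_
  have hr' := Finset.Icc_subset_Icc_right hs hr
  exact sup_le (sup_le (ha r hr').comap_le (hX r hr').comap_le) (hY r hr').comap_le

theorem preReward_le [m0 : MeasurableSpace Ω] {T : ℕ}
    (ha : ∀ s ∈ Finset.Icc 1 T, Measurable (a s))
    (hX : ∀ s ∈ Finset.Icc 1 T, Measurable (chosen a X s))
    (hY : ∀ s ∈ Finset.Icc 1 T, Measurable (chosen a Y s)) {s : ℕ} (hs : s ∈ Finset.Icc 1 T) :
    preReward a X Y s ≤ m0 := by
  have hs' := Finset.mem_Icc.1 hs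
  exact sup_le (history_le ha hX hY (by omega)) (sup_le (ha s hs).comap_le (hX s hs).comap_le)

end History

/-! ### Deterministic facts on least squares -/

section OLS

variable {d t : ℕ} {x : ℕ → Vec d} {κ : ℝ}

theorem isUnit_det_gram (hκ : 0 < κ)
    (hlow : ∀ u : Vec d, κ * ‖u‖ ^ 2 ≤ ∑ s ∈ Finset.Icc 1 t, inner ℝ (x s) u ^ 2) :
    IsUnit (gram x t).det := by
  rw [isUnit_iff_ne_zero]
  intro h0
  obtain ⟨v, hv, hMv⟩ := Matrix.exists_mulVec_eq_zero_iff.2 h0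
  have h1 := dotProduct_gram_mulVec x t (WithLp.toLp 2 v) (WithLp.toLp 2 v)
  rw [hMv, dotProduct_zero] at h1
  have h2 := hlow (WithLp.toLp 2 v)
  simp only [sq (inner ℝ _ _), ← h1] at h2
  have h3 : WithLp.toLp 2 v ≠ (0 : Vec d) := fun h => hv (by simpa using h)
  have : 0 < ‖WithLp.toLp 2 v‖ := norm_pos_iff.2 h3
  have : 0 < κ * ‖WithLp.toLp 2 v‖ ^ 2 := by positivity
  linarith

/-- These are the normal equations for the error, tested against `v`. -/
theorem sum_inner_ols_sub_mul_inner (hM : IsUnit (gram x t).det) {y e : ℕ → ℝ} {θs : Vec d}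
    (hy : ∀ s, y s = inner ℝ (x s) θs + e s) (v : Vec d) :
    ∑ s ∈ Finset.Icc 1 t, inner ℝ (x s) (ols x y t - θs) * inner ℝ (x s) v =
      ∑ s ∈ Finset.Icc 1 t, e s * inner ℝ (x s) v := by
  have h1 := dotProduct_gram_mulVec x t v (ols x y t)
  have h2 : (gram x t).mulVec (ols x y t).ofLp = (respSum x y t).ofLp := by
    unfold ols
    rw [Matrix.mulVec_mulVec, Matrix.mul_nonsing_inv _ hM, Matrix.one_mulVec]
  have h3 : v.ofLp ⬝ᵥ (respSum x y t).ofLp = ∑ s ∈ Finset.Icc 1 t, y s * inner ℝ (x s) v := by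
    have : v.ofLp ⬝ᵥ (respSum x y t).ofLp = inner ℝ (respSum x y t) v := by
      rw [EuclideanSpace.inner_eq_star_dotProduct]; simp
    rw [this, respSum, sum_inner]
    simp only [real_inner_smul_left]
  rw [h2, h3] at h1
  simp only [hy, add_mul, Finset.sum_add_distrib] at h1
  simp only [inner_sub_right, sub_mul, Finset.sum_sub_distrib]
  have h4 : ∑ s ∈ Finset.Icc 1 t, inner ℝ (x s) (ols x y t) * inner ℝ (x s) v =
      ∑ s ∈ Finset.Icc 1 t, inner ℝ (x s) v * inner ℝ (x s) (ols x y t) :=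
    Finset.sum_congr rfl fun s _ => mul_comm _ _
  linarith

/-- Both sides bound the trace of the Gram matrix: sum the lower bound over the standard basis. It
shows that a dimension larger than `T` is incompatible with the good events. -/
theorem card_mul_le_of_forall_norm_le {L : ℝ}
    (hlow : ∀ u : Vec d, κ * ‖u‖ ^ 2 ≤ ∑ s ∈ Finset.Icc 1 t, inner ℝ (x s) u ^ 2)
    (hup : ∀ s ∈ Finset.Icc 1 t, ‖x s‖ ≤ L) : d * κ ≤ t * L ^ 2 := by
  have h1 : ∑ _j : Fin d, κ ≤ ∑ j : Fin d, ∑ s ∈ Finset.Icc 1 t, (x s j) ^ 2 := by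
    refine Finset.sum_le_sum fun j _ => ?_
    simpa [EuclideanSpace.inner_single_right] using hlow (EuclideanSpace.single j (1 : ℝ))
  rw [Finset.sum_comm] at h1
  simp only [← EuclideanSpace.real_norm_sq_eq] at h1
  have h2 : ∑ s ∈ Finset.Icc 1 t, ‖x s‖ ^ 2 ≤ ∑ _s ∈ Finset.Icc 1 t, L ^ 2 :=
    Finset.sum_le_sum fun s hs => by have := hup s hs; gcongr
  simpa using h1.trans h2

end OLS

/-- A single diagonal entry suffices. The bound serves to show that `xmax` is positive. -/
theorem le_integral_sq_norm_of_diversity {Ω : Type*} {m m0 : MeasurableSpace Ω} {μ : Measure Ω}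
    [IsProbabilityMeasure μ] (hm : m ≤ m0) {d : ℕ} (hd : 1 ≤ d) {x : Ω → Vec d}
    (hx : Measurable x) (hx2 : Integrable (fun ω => ‖x ω‖ ^ 2) μ) {lam : ℝ}
    (hdiv : ∀ᵐ ω ∂μ,
      (condSecondMoment μ m x ω - lam • (1 : Matrix (Fin d) (Fin d) ℝ)).PosSemidef) :
    lam ≤ ∫ ω, ‖x ω‖ ^ 2 ∂μ := by
  let j : Fin d := ⟨0, hd⟩
  have h1 : ∀ᵐ ω ∂μ, lam ≤ (μ[fun ω' => x ω' j * x ω' j | m]) ω := by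
    filter_upwards [hdiv] with ω hω
    have := hω.diag_nonneg (i := j)
    simp [condSecondMoment] at this
    linarith
  have h2 := integral_mono_ae (integrable_const lam) integrable_condExp h1
  rw [integral_condExp hm, integral_const, probReal_univ, one_smul] at h2
  refine h2.trans (integral_mono (integrable_mul_apply_of_sq hx hx2 j j) hx2 fun ω => ?_)
  have h3 : |x ω j| ≤ ‖x ω‖ := by simpa using PiLp.norm_apply_le (x ω) j
  have h4 := pow_le_pow_left₀ (abs_nonneg _) h3 2
  simp only
  rw [sq_abs] at h4
  linarith

/-! ### The constants -/

/-- The constant `c₀` of the truncation radius. -/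
noncomputable def truncConst : ℝ := 2 * Real.exp 4

section Constants

variable {d K T : ℕ} {xmax lam : ℝ}

theorem one_le_log_natCast (hT : 3 ≤ T) : 1 ≤ Real.log T := by
  rw [Real.le_log_iff_exp_le (by positivity)]
  have : (3 : ℝ) ≤ T := by exact_mod_cast hT
  linarith [Real.exp_one_lt_d9]

theorem natCast_le_mul_mul (hd : 1 ≤ d) (hK : 1 ≤ K) : (T : ℝ) ≤ (d : ℝ) * K * T := by
  have h1 : (1 : ℝ) ≤ d := by exact_mod_cast hd
  have h2 : (1 : ℝ) ≤ K := by exact_mod_cast hK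
  exact le_mul_of_one_le_left (by positivity) (one_le_mul_of_one_le_of_one_le h1 h2)

theorem le_truncRadius (hd : 1 ≤ d) (hK : 1 ≤ K) (hT : 3 ≤ T) (hx : 0 ≤ xmax) (hlam : 0 < lam) :
    truncConst * √(d : ℝ) * xmax * (1 + 3 * Real.log ((d : ℝ) * K * T)) ≤
      truncRadius truncConst d K T xmax lam := by
  have hmin : 0 < min lam 1 := lt_min hlam one_pos
  have hN : 0 < (d : ℝ) * K * T := by positivity
  have h1 : Real.log ((d : ℝ) * K * T) ≤ Real.log ((d : ℝ) * K * T / min lam 1) :=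
    Real.log_le_log hN ((le_div_iff₀ hmin).2 (mul_le_of_le_one_right hN.le (min_le_right _ _)))
  unfold truncRadius truncConst
  gcongr

theorem one_le_log_mul_mul (hd : 1 ≤ d) (hK : 1 ≤ K) (hT : 3 ≤ T) :
    1 ≤ Real.log ((d : ℝ) * K * T) :=
  (one_le_log_natCast hT).trans (Real.log_le_log (by positivity) (natCast_le_mul_mul hd hK))

theorem truncRadius_pos (hd : 1 ≤ d) (hK : 1 ≤ K) (hT : 3 ≤ T) (hx : 0 < xmax) (hlam : 0 < lam) :
    0 < truncRadius truncConst d K T xmax lam := by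
  refine lt_of_lt_of_le ?_ (le_truncRadius hd hK hT hx.le hlam)
  have := one_le_log_mul_mul hd hK hT
  unfold truncConst
  positivity

/-- The order of the moment used to bound the tails. -/
noncomputable def momentOrder (d K T : ℕ) : ℕ := ⌈Real.log ((d : ℝ) * K * T)⌉₊ + 1

theorem mul_momentOrder_le (hd : 1 ≤ d) (hK : 1 ≤ K) (hT : 3 ≤ T) (hx : 0 ≤ xmax)
    (hlam : 0 < lam) :
    d * (2 * momentOrder d K T * xmax) ^ 2 ≤
      Real.exp (-8) * truncRadius truncConst d K T xmax lam ^ 2 := by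
  have hlog := one_le_log_mul_mul hd hK hT
  set l := Real.log ((d : ℝ) * K * T) with hl
  -- The order is less than `l + 2`, and `l ≥ 1` for `T ≥ 3`.
  have hm : (momentOrder d K T : ℝ) ≤ 1 + 3 * l := by
    have := Nat.ceil_lt_add_one (show 0 ≤ l by linarith)
    unfold momentOrder
    push_cast
    linarith
  have hL := le_truncRadius hd hK hT hx hlam
  have h0 : 0 ≤ truncConst * √(d : ℝ) * xmax * (1 + 3 * l) := by unfold truncConst; positivity
  have hL2 := pow_le_pow_left₀ h0 hL 2
  -- The choice `c₀ = 2 e⁴` gives the tail ratio `q = e⁻⁸`; its power of order at least `log(dKT)`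
  -- is at most `(dKT)⁻⁸`.
  have he : Real.exp (-8) * truncConst ^ 2 = 4 := by
    unfold truncConst
    rw [mul_pow, ← Real.exp_nat_mul, mul_left_comm, ← Real.exp_add]
    norm_num
  calc (d : ℝ) * (2 * momentOrder d K T * xmax) ^ 2 ≤ d * (2 * (1 + 3 * l) * xmax) ^ 2 := by gcongr
    _ = Real.exp (-8) * truncConst ^ 2 * (d * xmax ^ 2 * (1 + 3 * l) ^ 2) := by rw [he]; ring
    _ = Real.exp (-8) * (truncConst * √(d : ℝ) * xmax * (1 + 3 * l)) ^ 2 := by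
        rw [mul_pow, mul_pow, mul_pow, Real.sq_sqrt (by positivity)]; ring
    _ ≤ _ := by gcongr

theorem exp_neg_pow_momentOrder_le (hd : 1 ≤ d) (hK : 1 ≤ K) (hT : 3 ≤ T) :
    Real.exp (-8) ^ momentOrder d K T ≤ (((d : ℝ) * K * T) ^ 8)⁻¹ := by
  have hN : 0 < (d : ℝ) * K * T := by positivity
  have hm : Real.log ((d : ℝ) * K * T) ≤ momentOrder d K T := by
    unfold momentOrder
    push_cast
    linarith [Nat.le_ceil (Real.log ((d : ℝ) * K * T))]
  rw [← Real.exp_nat_mul]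
  calc Real.exp (momentOrder d K T * -8) ≤ Real.exp (-(8 * Real.log ((d : ℝ) * K * T))) :=
        Real.exp_le_exp.2 (by linarith)
    _ = _ := by
        rw [Real.exp_neg]
        congr 1
        have := Real.exp_nat_mul (Real.log ((d : ℝ) * K * T)) 8
        rw [Real.exp_log hN] at this
        exact_mod_cast this

theorem sq_truncRadius_mul_le {t : ℕ} (h : burnIn truncConst (1 / 10) d K T xmax lam ≤ t) :
    20 * (truncRadius truncConst d K T xmax lam ^ 2 / lam) * (2 * Real.log T + Real.log d) ≤ t := by
  refine le_trans (le_of_eq ?_) h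
  unfold burnIn
  norm_num

end Constants

/-! ### Numerical bounds on the failure probabilities. -/

section Bounds

variable {d K T t : ℕ} {V lam : ℝ}

theorem sq_div_le_of_burnIn (hlam : 0 < lam) (hV : 0 < V)
    (h : 20 * (V / lam) * (2 * Real.log T + Real.log d) ≤ t) :
    40 * (V / lam) * Real.log T ≤ t := by
  have h1 : 0 ≤ Real.log d := Real.log_natCast_nonneg d
  have h2 : 0 ≤ V / lam * Real.log d := by positivity
  linarith

/-- The exponent is `-(3/10 - 1/8) lam t / V`, and the burn-in gives `lam t / V ≥ 20 (2 log T + log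
d)`; the product absorbs the dimension factor and leaves `T⁻²`. -/
theorem chernoff_term_le (hd : 1 ≤ d) (hT : 3 ≤ T) (hlam : 0 < lam) (hV : 0 < V)
    (h : 20 * (V / lam) * (2 * Real.log T + Real.log d) ≤ t) :
    d * Real.exp (lam * t / (8 * V) - 3 / 10 * (lam / V) * t) ≤ ((T : ℝ) ^ 2)⁻¹ := by
  have hd0 : (0 : ℝ) < d := by exact_mod_cast hd
  have hT0 : (0 : ℝ) < T := by positivity
  have h1 : 0 ≤ Real.log d := Real.log_natCast_nonneg d
  have hl := one_le_log_natCast hT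
  have h2 : 20 * (2 * Real.log T + Real.log d) ≤ lam / V * t := by
    calc 20 * (2 * Real.log T + Real.log d)
        = lam / V * (20 * (V / lam) * (2 * Real.log T + Real.log d)) := by field_simp
      _ ≤ _ := by gcongr
  have h3 : lam * t / (8 * V) = lam / V * t / 8 := by field_simp
  have h4 : ((T : ℝ) ^ 2)⁻¹ = Real.exp (-(2 * Real.log T)) := by
    rw [Real.exp_neg, two_mul, Real.exp_add, Real.exp_log hT0, sq]
  rw [h3, h4]
  nth_rewrite 1 [← Real.exp_log hd0]
  rw [← Real.exp_add, Real.exp_le_exp]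
  linarith

theorem tail_term_le {N k : ℝ} (hT : 3 ≤ T) (hTN : (T : ℝ) ≤ N) (hk : k ≤ N ^ 2) :
    k * (N ^ 8)⁻¹ ≤ ((T : ℝ) ^ 2)⁻¹ := by
  have hT1 : (3 : ℝ) ≤ T := by exact_mod_cast hT
  have hN : 1 ≤ N := by linarith
  calc k * (N ^ 8)⁻¹ ≤ N ^ 2 * (N ^ 8)⁻¹ := by gcongr
    _ = (N ^ 6)⁻¹ := by field_simp
    _ ≤ (N ^ 2)⁻¹ := by gcongr; norm_num
    _ ≤ _ := by gcongr

/-- A grid side has at most `T^7` points, so the cardinality is at most `exp(7 d log T)`, while `28²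
/ 8 = 98`. -/
theorem grid_term_le (hd : 1 ≤ d) (hT : 3 ≤ T) :
    ((2 * (80 * T ^ 2 + 1) + 1 : ℕ) : ℝ) ^ d *
      Real.exp (-((28 * √(d * Real.log T)) ^ 2 / 8)) ≤ ((T : ℝ) ^ 2)⁻¹ := by
  have hd1 : (1 : ℝ) ≤ d := by exact_mod_cast hd
  have hT1 : (3 : ℝ) ≤ T := by exact_mod_cast hT
  have hT0 : (0 : ℝ) < T := by linarith
  have hl := one_le_log_natCast hT
  have h1 : ((2 * (80 * T ^ 2 + 1) + 1 : ℕ) : ℝ) ≤ (T : ℝ) ^ 7 := by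
    have h2 : (3 : ℝ) ^ 5 ≤ (T : ℝ) ^ 5 := by gcongr
    have h3 : (T : ℝ) ^ 7 = T ^ 5 * T ^ 2 := by ring
    rw [h3]
    push_cast
    nlinarith [sq_nonneg (T : ℝ)]
  have h7 : (T : ℝ) ^ 7 = Real.exp (7 * Real.log T) := by
    have := Real.exp_nat_mul (Real.log T) 7
    rw [Real.exp_log hT0] at this
    exact_mod_cast this.symm
  have h4 : ((T : ℝ) ^ 2)⁻¹ = Real.exp (-(2 * Real.log T)) := by
    rw [Real.exp_neg, two_mul, Real.exp_add, Real.exp_log hT0, sq]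
  rw [mul_pow, Real.sq_sqrt (by positivity), h4]
  calc _ ≤ Real.exp (7 * Real.log T) ^ d * Real.exp (-(28 ^ 2 * (d * Real.log T) / 8)) := by
        rw [← h7]; gcongr
    _ = Real.exp (-(91 * (d * Real.log T))) := by
        rw [← Real.exp_nat_mul, ← Real.exp_add]; congr 1; ring
    _ ≤ _ := Real.exp_le_exp.2 (by nlinarith)

end Bounds

/-! ### The estimation error -/

section Main

variable {Ω : Type*} [MeasurableSpace Ω] {μ : Measure Ω} {d K T : ℕ}
  {θs θ₀ : Vec d} {σ : ℝ} {X : ℕ → Fin K → Ω → Vec d} {η : ℕ → Fin K → Ω → ℝ}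
  {a : ℕ → Ω → Fin K}

namespace IsLinGreedyRun

theorem measurable_chosen_context (hrun : IsLinGreedyRun μ T θs θ₀ σ X η a) {s : ℕ}
    (hs : s ∈ Finset.Icc 1 T) : Measurable (chosen a X s) :=
  measurable_chosen (hrun.measurable_arm s hs) (hrun.measurable_context s hs)

theorem measurable_chosen_noise (hrun : IsLinGreedyRun μ T θs θ₀ σ X η a) {s : ℕ}
    (hs : s ∈ Finset.Icc 1 T) : Measurable (chosen a η s) :=
  measurable_chosen (hrun.measurable_arm s hs) (hrun.measurable_noise s hs)

theorem measurable_chosen_reward (hrun : IsLinGreedyRun μ T θs θ₀ σ X η a) {s : ℕ}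
    (hs : s ∈ Finset.Icc 1 T) : Measurable (chosen a (reward θs X η) s) := by
  refine measurable_chosen (hrun.measurable_arm s hs) fun i => ?_
  have h1 := hrun.measurable_context s hs i
  have h2 := hrun.measurable_noise s hs i
  unfold reward
  fun_prop

theorem history_le (hrun : IsLinGreedyRun μ T θs θ₀ σ X η a) {s : ℕ} (hs : s ≤ T) :
    history a X (reward θs X η) s ≤ ‹MeasurableSpace Ω› :=
  _root_.history_le hrun.measurable_arm (fun _ => hrun.measurable_chosen_context)
    (fun _ => hrun.measurable_chosen_reward) hs

theorem preReward_le (hrun : IsLinGreedyRun μ T θs θ₀ σ X η a) {s : ℕ}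
    (hs : s ∈ Finset.Icc 1 T) : preReward a X (reward θs X η) s ≤ ‹MeasurableSpace Ω› :=
  _root_.preReward_le hrun.measurable_arm (fun _ => hrun.measurable_chosen_context)
    (fun _ => hrun.measurable_chosen_reward) hs

variable [IsProbabilityMeasure μ]

theorem psiOne_bound_pos (hrun : IsLinGreedyRun μ T θs θ₀ σ X η a) (hd : 1 ≤ d) (hT : 1 ≤ T)
    {xmax lam : ℝ} (hlam : 0 < lam)
    (hpsi : ∀ t ∈ Finset.Icc 1 T, ∀ i, psiOneNormVec μ (X t i) ≤ ENNReal.ofReal xmax)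
    (hdiv : IsDiversityConstant μ T X (reward θs X η) a lam) : 0 < xmax := by
  by_contra hx
  have hmem : 1 ∈ Finset.Icc 1 T := Finset.mem_Icc.2 ⟨le_rfl, hT⟩
  have hpsi0 : ∀ i, psiOneNormVec μ (X 1 i) ≤ ENNReal.ofReal 0 := fun i =>
    (hpsi 1 hmem i).trans (by rw [ENNReal.ofReal_of_nonpos (not_lt.1 hx)]; simp)
  have hm := hrun.measurable_context 1 hmem
  have h1 := le_integral_sq_norm_of_diversity (hrun.history_le (Nat.zero_le T)) hd
    (hrun.measurable_chosen_context hmem)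
    (integrable_sq_norm_chosen (hrun.measurable_arm 1 hmem) hm le_rfl hpsi0) (hdiv 1 hmem)
  have h3 := fun i => integrable_norm_pow_and_integral_le (hm i) le_rfl (hpsi0 i) le_rfl
  have h4 : ∫ ω, ‖chosen a X 1 ω‖ ^ 2 ∂μ ≤ ∫ ω, ∑ i, ‖X 1 i ω‖ ^ 2 ∂μ :=
    integral_mono_of_nonneg (Filter.Eventually.of_forall fun ω => by positivity)
      (integrable_finsetSum Finset.univ fun i _ => (h3 i).1)
      (Filter.Eventually.of_forall
        (comp_chosen_le_sum (f := fun v : Vec d => ‖v‖ ^ 2) fun v => by positivity))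
  have h5 : ∫ ω, ∑ i, ‖X 1 i ω‖ ^ 2 ∂μ ≤ 0 := by
    rw [integral_finsetSum Finset.univ fun i _ => (h3 i).1]
    exact Finset.sum_nonpos fun i _ => by simpa using (h3 i).2
  linarith

theorem ae_noise_eq_zero (hrun : IsLinGreedyRun μ T θs θ₀ 0 X η a) :
    ∀ᵐ ω ∂μ, ∀ s ∈ Finset.Icc 1 T, chosen a η s ω = 0 := by
  refine (Filter.eventually_all_finset _).2 fun s hs => ?_
  refine ae_eq_zero_of_condExp_exp_le_one (hrun.preReward_le hs) (hrun.noise_integrable s hs)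
    fun l => ?_
  simpa using hrun.noise_subGaussian s hs l

/-- Outside an event of small probability, the least squares error is small whenever the contexts
are bounded and the Gram matrix is well conditioned. -/
theorem exists_noise_event (hrun : IsLinGreedyRun μ T θs θ₀ σ X η a) (hσ : 0 ≤ σ) (hd : 1 ≤ d)
    (hT : 3 ≤ T) (hdT : d ≤ T) {t : ℕ} (ht : t ∈ Finset.Icc 1 T) {lam L : ℝ} (hlam : 0 < lam)
    (hL : 0 < L) (hLt : 40 * (L ^ 2 / lam) * Real.log T ≤ t) :
    ∃ B : Set Ω, μ.real B ≤ ((T : ℝ) ^ 2)⁻¹ ∧ ∀ ω ∉ B,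
      (∀ s ∈ Finset.Icc 1 t, ‖chosen a X s ω‖ ≤ L) →
      (∀ u : Vec d, lam * t / 8 * ‖u‖ ^ 2 ≤
        ∑ s ∈ Finset.Icc 1 t, inner ℝ (chosen a X s ω) u ^ 2) →
      ‖ols (fun s => chosen a X s ω) (fun s => chosen a (reward θs X η) s ω) t - θs‖ ≤
        80 * σ * (√((d : ℝ) * Real.log T) / √(lam * t)) := by
  obtain ⟨ht1, htT⟩ := Finset.mem_Icc.1 ht
  have ht0 : (0 : ℝ) < t := by exact_mod_cast ht1
  have hd0 : (0 : ℝ) < d := by exact_mod_cast hd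
  have hκ : 0 < lam * t / 8 := by positivity
  have hE := fun ω hlow => sum_inner_ols_sub_mul_inner
    (isUnit_det_gram (t := t) (x := fun s => chosen a X s ω) hκ hlow)
    (fun s => chosen_reward_eq a X θs η s ω)
  rcases hσ.eq_or_lt with rfl | hσ0
  · refine ⟨{ω | ¬ ∀ s ∈ Finset.Icc 1 T, chosen a η s ω = 0}, ?_, fun ω hω _ hlow => ?_⟩
    · have h0 : μ {ω | ¬ ∀ s ∈ Finset.Icc 1 T, chosen a η s ω = 0} = 0 := hrun.ae_noise_eq_zero
      rw [measureReal_def, h0]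
      simp
    · have hω' : ∀ s ∈ Finset.Icc 1 T, chosen a η s ω = 0 := not_not.1 hω
      set E := ols (fun s => chosen a X s ω) (fun s => chosen a (reward θs X η) s ω) t - θs
      have h1 : ∑ s ∈ Finset.Icc 1 t, inner ℝ (chosen a X s ω) E ^ 2 =
          ∑ s ∈ Finset.Icc 1 t, chosen a η s ω * inner ℝ (chosen a X s ω) E := by
        simpa only [sq] using hE ω hlow E
      have h2 : ∑ s ∈ Finset.Icc 1 t, chosen a η s ω * inner ℝ (chosen a X s ω) E = 0 :=
        Finset.sum_eq_zero fun s hs => by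
          rw [hω' s (Finset.Icc_subset_Icc_right htT hs), zero_mul]
      have h3 := hlow E
      rw [h1, h2] at h3
      have h4 : ‖E‖ ^ 2 ≤ 0 := nonpos_of_mul_nonpos_right h3 hκ
      have h5 : ‖E‖ = 0 := by simpa using le_antisymm h4 (by positivity)
      rw [h5]
      positivity
  have hl := one_le_log_natCast hT
  have hT0 : (0 : ℝ) < T := by positivity
  set D : ℝ := √((d : ℝ) * Real.log T) with hD
  have hd1 : (1 : ℝ) ≤ d := by exact_mod_cast hd
  have hdl : 1 ≤ (d : ℝ) * Real.log T := one_le_mul_of_one_le_of_one_le hd1 hl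
  have hD1 : 1 ≤ D := Real.one_le_sqrt.2 hdl
  have hD2 : D ^ 2 = (d : ℝ) * Real.log T := Real.sq_sqrt (by positivity)
  set r : ℝ := 80 * σ * (D / √(lam * t)) with hr
  have hr0 : 0 < r := by positivity
  have hr2 : r ^ 2 = 6400 * σ ^ 2 * ((d : ℝ) * Real.log T) / (lam * t) := by
    rw [hr, mul_pow, div_pow, hD2, Real.sq_sqrt (by positivity)]
    ring
  set h : ℝ := (√(d * L ^ 2 * t * σ ^ 2))⁻¹ with hh
  have hh0 : 0 < h := by positivity
  have hh2 : h ^ 2 * (d * L ^ 2 * t * σ ^ 2) = 1 := by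
    rw [hh, inv_pow, Real.sq_sqrt (by positivity)]
    exact inv_mul_cancel₀ (by positivity)
  -- The number of mesh steps in the radius is polynomial in `T`: the burn-in bounds `L² / lam · log
  -- T` by `T`, and `d ≤ T`.
  have hM : r / σ ^ 2 / h + 1 ≤ ((80 * T ^ 2 + 1 : ℕ) : ℝ) := by
    push_cast
    have h1 : (r / σ ^ 2 / h) ^ 2 ≤ (80 * (T : ℝ) ^ 2) ^ 2 := by
      have e1 : (h ^ 2)⁻¹ = d * L ^ 2 * t * σ ^ 2 := inv_eq_of_mul_eq_one_right hh2
      have e2 : (r / σ ^ 2 / h) ^ 2 = 6400 * (d : ℝ) ^ 2 * (L ^ 2 / lam * Real.log T) := by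
        rw [div_pow, div_pow, div_eq_mul_inv _ (h ^ 2), e1, hr2]
        field_simp
      have e3 : L ^ 2 / lam * Real.log T ≤ T := by
        have : (t : ℝ) ≤ T := by exact_mod_cast htT
        have : 0 ≤ L ^ 2 / lam * Real.log T := by positivity
        linarith
      have e4 : (d : ℝ) ≤ T := by exact_mod_cast hdT
      have e5 : (1 : ℝ) ≤ T := by exact_mod_cast (by omega : 1 ≤ T)
      rw [e2]
      calc 6400 * (d : ℝ) ^ 2 * (L ^ 2 / lam * Real.log T) ≤ 6400 * (T : ℝ) ^ 2 * T := by gcongr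
        _ = 6400 * (T : ℝ) ^ 3 := by ring
        _ ≤ 6400 * (T : ℝ) ^ 4 := by gcongr; norm_num
        _ = _ := by ring
    have := (pow_le_pow_iff_left₀ (by positivity) (by positivity) two_ne_zero).1 h1
    linarith
  set N : Finset (Fin d → ℤ) := Fintype.piFinset fun _ : Fin d =>
    Finset.Icc (-((80 * T ^ 2 + 1 : ℕ) : ℤ)) (80 * T ^ 2 + 1 : ℕ) with hN
  have hcard : (N.card : ℝ) = ((2 * (80 * T ^ 2 + 1) + 1 : ℕ) : ℝ) ^ d := by
    have : (((80 * T ^ 2 + 1 : ℕ) : ℤ) + 1 - -((80 * T ^ 2 + 1 : ℕ) : ℤ)).toNat =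
        2 * (80 * T ^ 2 + 1) + 1 := by omega
    rw [hN, Fintype.card_piFinset_const, Int.card_Icc, this]
    push_cast
    rfl
  have hxm := fun s (hs : s ∈ Finset.Icc 1 t) =>
    hrun.measurable_chosen_context (Finset.Icc_subset_Icc_right htT hs)
  have hem := fun s (hs : s ∈ Finset.Icc 1 t) =>
    hrun.measurable_chosen_noise (Finset.Icc_subset_Icc_right htT hs)
  refine ⟨{ω | ∃ k ∈ N, (28 * D) ^ 2 / 8 ≤ selfNormExponent σ (fun s => chosen a X s ω)
    (fun s => chosen a η s ω) (gridPoint h k) t}, ?_, fun ω hω hup hlow => ?_⟩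
  · refine (measureReal_exists_le_selfNormExponent_le hxm hem (fun v => ?_) N (gridPoint h)
      _).trans ?_
    · exact lintegral_exp_selfNormExponent_le (𝒢 := preReward a X (reward θs X η))
        (fun s hs => hrun.preReward_le hs)
        (fun s _ r hr => measurable_chosen_context_preReward hr)
        (fun s _ r hr => measurable_chosen_noise_preReward hr)
        (fun s hs => hrun.measurable_chosen_noise hs) hrun.noise_integrable
        hrun.noise_subGaussian v t htT
    · rw [hcard]
      exact grid_term_le hd hT
  · by_contra hcon
    refine hω (exists_le_selfNormExponent_of_norm_gt (hE ω hlow) hσ0 hlow hup hr0 (not_le.1 hcon)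
      (by linarith) ?_ hh0 ?_ hM)
    -- The constant `80` fits here: `80² / 8 = 800` exceeds `28² = 784`.
    · rw [hr2, mul_pow, hD2]
      have : 6400 * σ ^ 2 * ((d : ℝ) * Real.log T) / (lam * t) * (lam * t / 8) =
          800 * (σ ^ 2 * ((d : ℝ) * Real.log T)) := by field_simp; norm_num
      rw [this]
      have : 0 ≤ σ ^ 2 * ((d : ℝ) * Real.log T) := by positivity
      linarith
    · refine le_of_eq ?_
      rw [← hh2]; ring

/-- The least squares error is small with high probability, for horizons `T ≥ 3`. -/
theorem measureReal_not_le (hrun : IsLinGreedyRun μ T θs θ₀ σ X η a) (hσ : 0 ≤ σ) (hd : 1 ≤ d)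
    (hK : 1 ≤ K) (hT : 3 ≤ T) {xmax lam : ℝ} (hlam : 0 < lam)
    (hpsi : ∀ t ∈ Finset.Icc 1 T, ∀ i, psiOneNormVec μ (X t i) ≤ ENNReal.ofReal xmax)
    (hdiv : IsDiversityConstant μ T X (reward θs X η) a lam) {t : ℕ} (ht : t ∈ Finset.Icc 1 T)
    (hburn : burnIn truncConst (1 / 10) d K T xmax lam ≤ t) :
    μ.real {ω | IsUnit (gram (fun s => chosen a X s ω) t).det ∧
      ‖ols (fun s => chosen a X s ω) (fun s => chosen a (reward θs X η) s ω) t - θs‖ ≤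
        80 * σ * (√((d : ℝ) * Real.log T) / √(lam * t))}ᶜ ≤ 4 / (T : ℝ) ^ 2 := by
  obtain ⟨ht1, htT⟩ := Finset.mem_Icc.1 ht
  have ht0 : (0 : ℝ) < t := by exact_mod_cast ht1
  have htT' : (t : ℝ) ≤ T := by exact_mod_cast htT
  have hT3 : (3 : ℝ) ≤ T := by exact_mod_cast hT
  have hd1 : (1 : ℝ) ≤ d := by exact_mod_cast hd
  have hx := hrun.psiOne_bound_pos hd (by omega) hlam hpsi hdiv
  have hL := truncRadius_pos (T := T) hd hK hT hx hlam
  have hq := mul_momentOrder_le (T := T) hd hK hT hx.le hlam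
  have hqm := exp_neg_pow_momentOrder_le (T := T) hd hK hT
  have hTN := natCast_le_mul_mul (T := T) hd hK
  have hb := sq_truncRadius_mul_le hburn
  have hmo : 1 ≤ momentOrder d K T := Nat.le_add_left 1 _
  set L := truncRadius truncConst d K T xmax lam
  set q := Real.exp (-8)
  set m := momentOrder d K T
  set N : ℝ := (d : ℝ) * K * T with hN
  have hLt := sq_div_le_of_burnIn hlam (by positivity : 0 < L ^ 2) hb
  have hl := one_le_log_natCast hT
  have hLlam : 0 < L ^ 2 / lam := by positivity
  have hLT : 40 * (L ^ 2 / lam) ≤ t := by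
    refine le_trans ?_ hLt
    exact le_mul_of_one_le_right (by positivity) hl
  have htK : (t : ℝ) * K ≤ N := by
    calc (t : ℝ) * K ≤ 1 * (T * K) := by rw [one_mul]; gcongr
      _ ≤ d * (T * K) := by gcongr
      _ = N := by rw [hN]; ring
  have hN0 : 0 ≤ N := by positivity
  have hsub := fun s (hs : s ∈ Finset.Icc 1 t) => Finset.Icc_subset_Icc_right htT hs
  set U : Set Ω := ⋃ s ∈ Finset.Icc 1 t, {ω | L < ‖chosen a X s ω‖} with hU
  set W : Set Ω := {ω | ¬ ∀ u : Vec d, lam * t / (8 * L ^ 2) * L ^ 2 * ‖u‖ ^ 2 ≤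
    ∑ s ∈ Finset.Icc 1 t, inner ℝ (chosen a X s ω) u ^ 2} with hW
  have hPU : μ.real U ≤ ((T : ℝ) ^ 2)⁻¹ := by
    refine (measureReal_biUnion_finset_le _ _).trans ?_
    have h1 : ∀ s ∈ Finset.Icc 1 t, μ.real {ω | L < ‖chosen a X s ω‖} ≤ K * (N ^ 8)⁻¹ :=
      fun s hs => (measureReal_lt_norm_chosen_le (hrun.measurable_context s (hsub s hs)) hx.le hL
        (hpsi s (hsub s hs)) hmo hq).trans (by gcongr)
    refine (Finset.sum_le_sum h1).trans ?_
    rw [Finset.sum_const, Nat.card_Icc, Nat.add_sub_cancel, nsmul_eq_mul, ← mul_assoc]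
    exact tail_term_le hT hTN (htK.trans (by nlinarith))
  have hPW : μ.real W ≤ ((T : ℝ) ^ 2)⁻¹ + ((T : ℝ) ^ 2)⁻¹ := by
    refine (measureReal_not_sum_inner_sq_ge_le (T := T) (ℋ := history a X (reward θs X η))
      history_mono (fun s hs => hrun.history_le hs)
      (fun s hs => measurable_chosen_context_history
        (Finset.mem_Icc.2 ⟨(Finset.mem_Icc.1 hs).1, le_rfl⟩))
      (fun s hs => integrable_sq_norm_chosen (hrun.measurable_arm s hs)
        (hrun.measurable_context s hs) hx.le (hpsi s hs)) hL hlam hdiv htT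
      (lam * t / (8 * L ^ 2))).trans (add_le_add ?_ ?_)
    · exact chernoff_term_le hd hT hlam (by positivity) hb
    · have h1 : ∀ s ∈ Finset.Icc 1 t, 2 / lam * ∫ ω, sqNormTail L (chosen a X s ω) ∂μ ≤
          2 / lam * (K * (L ^ 2 * (N ^ 8)⁻¹)) := fun s hs => by
        have := integral_sqNormTail_chosen_le (a := a) (hrun.measurable_context s (hsub s hs))
          hx.le hL (hpsi s (hsub s hs)) hmo hq
        have h2 : K * (L ^ 2 * q ^ m) ≤ K * (L ^ 2 * (N ^ 8)⁻¹) := by gcongr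
        have h3 : (0 : ℝ) ≤ 2 / lam := by positivity
        exact mul_le_mul_of_nonneg_left (this.trans h2) h3
      refine (Finset.sum_le_sum h1).trans ?_
      rw [Finset.sum_const, Nat.card_Icc, Nat.add_sub_cancel, nsmul_eq_mul]
      -- The burn-in gives `2 L² / lam ≤ t ≤ N`, so the prefactor is at most `N²`, free of `lam`.
      have h2 : (t : ℝ) * (2 / lam * (K * (L ^ 2 * (N ^ 8)⁻¹))) =
          (t * K) * (2 * (L ^ 2 / lam)) * (N ^ 8)⁻¹ := by field_simp
      rw [h2]
      refine tail_term_le hT hTN ?_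
      rw [sq N]
      exact mul_le_mul htK (by linarith) (by positivity) hN0
  have hup : ∀ ω ∉ U, ∀ s ∈ Finset.Icc 1 t, ‖chosen a X s ω‖ ≤ L := by
    intro ω hω s hs
    by_contra hcon
    exact hω (Set.mem_biUnion hs (not_le.1 hcon))
  have hlow : ∀ ω ∉ W, ∀ u : Vec d, lam * t / 8 * ‖u‖ ^ 2 ≤
      ∑ s ∈ Finset.Icc 1 t, inner ℝ (chosen a X s ω) u ^ 2 := by
    intro ω hω u
    have h1 : ∀ u : Vec d, lam * t / (8 * L ^ 2) * L ^ 2 * ‖u‖ ^ 2 ≤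
      ∑ s ∈ Finset.Icc 1 t, inner ℝ (chosen a X s ω) u ^ 2 := not_not.1 hω
    have h2 : lam * t / (8 * L ^ 2) * L ^ 2 = lam * t / 8 := by field_simp
    rw [← h2]
    exact h1 u
  have hfin : 4 / (T : ℝ) ^ 2 = ((T : ℝ) ^ 2)⁻¹ + (((T : ℝ) ^ 2)⁻¹ + ((T : ℝ) ^ 2)⁻¹) +
      ((T : ℝ) ^ 2)⁻¹ := by ring
  have hκ : 0 < lam * t / 8 := by positivity
  rw [hfin]
  -- For `d > T` the grid count is not needed: outside `U ∪ W` the trace comparison would give `d ≤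
  -- 8 L² / lam ≤ t ≤ T`, so `U ∪ W` is the whole space.
  by_cases hdT : d ≤ T
  · obtain ⟨B, hB, hBω⟩ := hrun.exists_noise_event hσ hd hT hdT ht hlam hL hLt
    refine (measureReal_mono (s₂ := U ∪ W ∪ B) fun ω hω => ?_).trans
      ((measureReal_union_le _ _).trans
        (add_le_add ((measureReal_union_le _ _).trans (add_le_add hPU hPW)) hB))
    by_contra hcon
    simp only [Set.mem_union, not_or] at hcon
    obtain ⟨⟨h1, h2⟩, h3⟩ := hcon
    exact hω ⟨isUnit_det_gram hκ (hlow ω h2), hBω ω h3 (hup ω h1) (hlow ω h2)⟩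
  · refine (measureReal_mono (s₂ := U ∪ W) fun ω _ => ?_).trans
      ((measureReal_union_le _ _).trans ((add_le_add hPU hPW).trans
        (le_add_of_nonneg_right (by positivity))))
    by_contra hcon
    simp only [Set.mem_union, not_or] at hcon
    have h1 := card_mul_le_of_forall_norm_le (hlow ω hcon.2) (hup ω hcon.1)
    have h2 : (d : ℝ) ≤ 8 * (L ^ 2 / lam) := by
      have h3 : (d : ℝ) * (lam * t / 8) = t * (d * lam / 8) := by ring
      rw [h3] at h1
      have h4 := le_of_mul_le_mul_left h1 ht0
      rw [mul_div_assoc', le_div_iff₀ hlam]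
      linarith
    have h3 : (d : ℝ) ≤ T := by linarith
    exact hdT (by exact_mod_cast h3)

end IsLinGreedyRun

end Main

theorem mainTheorem10 :
    ∃ c₀ c₁ c : ℝ, 0 < c₀ ∧ 0 < c₁ ∧ 0 < c ∧
      ∀ (Ω : Type*) [MeasurableSpace Ω] (μ : Measure Ω) [IsProbabilityMeasure μ]
        (d K T : ℕ) (_ : 1 ≤ d) (_ : 2 ≤ K)
        (θs θ₀ : Vec d) (σ xmax lam : ℝ) (_ : 0 ≤ σ) (_ : 0 < lam)
        (X : ℕ → Fin K → Ω → Vec d) (η : ℕ → Fin K → Ω → ℝ) (a : ℕ → Ω → Fin K)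
        (_ : IsLinGreedyRun μ T θs θ₀ σ X η a)
        (_ : ∀ t ∈ Finset.Icc 1 T, ∀ i, psiOneNormVec μ (X t i) ≤ ENNReal.ofReal xmax)
        (_ : IsDiversityConstant μ T X (reward θs X η) a lam)
        (t : ℕ) (_ : t ∈ Finset.Icc 1 T) (_ : burnIn c₀ c₁ d K T xmax lam ≤ (t : ℝ)),
        1 - 4 / (T : ℝ) ^ 2 ≤
          μ.real {ω |
            IsUnit (gram (fun s => chosen a X s ω) t).det ∧
            ‖ols (fun s => chosen a X s ω) (fun s => chosen a (reward θs X η) s ω) t - θs‖ ≤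
              c * σ * (√((d : ℝ) * Real.log T) / √(lam * t))} := by
  refine ⟨truncConst, 1 / 10, 80, by unfold truncConst; positivity, by norm_num, by norm_num, ?_⟩
  intro Ω _ μ _ d K T hd hK θs θ₀ σ xmax lam hσ hlam X η a hrun hpsi hdiv t ht hburn
  have hT1 : 1 ≤ T := (Finset.mem_Icc.1 ht).1.trans (Finset.mem_Icc.1 ht).2
  -- For `T ≤ 2` the claimed lower bound `1 - 4 / T²` is at most `0`.
  rcases Nat.lt_or_ge T 3 with hT | hT
  · refine le_trans ?_ measureReal_nonneg
    have h1 : (1 : ℝ) ≤ T := by exact_mod_cast hT1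
    have h2 : (T : ℝ) ≤ 2 := by exact_mod_cast (by omega : T ≤ 2)
    rw [sub_nonpos, le_div_iff₀ (by positivity)]
    nlinarith
  · have h1 := hrun.measureReal_not_le hσ hd (by omega) hT hlam hpsi hdiv ht hburn
    set S : Set Ω := {ω | IsUnit (gram (fun s => chosen a X s ω) t).det ∧
      ‖ols (fun s => chosen a X s ω) (fun s => chosen a (reward θs X η) s ω) t - θs‖ ≤
        80 * σ * (√((d : ℝ) * Real.log T) / √(lam * t))}
    -- Subadditivity passes to the complement without measurability of `S`.
    have h2 : (1 : ℝ) ≤ μ.real S + μ.real Sᶜ := by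
      have := measureReal_union_le (μ := μ) S Sᶜ
      rwa [Set.union_compl_self, probReal_univ] at this
    linarith
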